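/- **Setting.** Let $N,d\in\mathbb{N}$ and let $\mathbb{Z}_-=\{\dots,-2,-1,0\}$. For integrable $f:\mathbb{R}^N\times\mathbb{R}^d\to\mathbb{R}$ put $\widehat f(\xi)=\int_{\mathbb{R}^N\times\mathbb{R}^d}e^{-2\pi \mathrm{i}\,y\cdot\xi}f(y)\,dy$. Let $\mathcal{F}$ be the set of continuous integrable $f:\mathbb{R}^N\times\mathbb{R}^d\to\mathbb{R}$ with $\|\widehat f\|_1<\infty$ and, for $R>0$, let $\mathcal{F}_R=\{f\in\mathcal{F}:\|\widehat f\|_1\le R\}$. A system $x_t=G(x_{t-1},z_t)$, $t\in\mathbb{Z}_-$, has the *echo state property* with states in $B\subset\mathbb{R}^N$ and inputs in $D\subset\mathbb{R}^d$ if every $z\in D^{\mathbb{Z}_-}$ admits exactly one solution $x\in B^{\mathbb{Z}_-}$; its *filter* then maps $z$ to this solution $x$. **Recurrent quantum neural network.** Fix $n\ge 1$. Let $\mathfrak n=\lceil\log_2(4n)\rceil$ be the number of qubits, so that $2^{\mathfrak n}$ is the least power of $2$ that is at least $4n$. Circuit parameters are $\theta=(a^i,b^i,\gamma^i)_{i=1}^n\in\Theta=(\mathbb{R}^{N+d}\times\mathbb{R}\times[0,2\pi])^n$.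 With the Hadamard gate $\mathtt H$ and the rotations $$\mathtt R_y(\gamma)=\begin{pmatrix}\cos\frac{\gamma}{2}&-\sin\frac{\gamma}{2}\\ \sin\frac{\gamma}{2}&\cos\frac{\gamma}{2}\end{pmatrix},\qquad \mathtt R_z(\alpha)=\begin{pmatrix}e^{-\mathrm i\alpha/2}&0\\0&e^{\mathrm i\alpha/2}\end{pmatrix},$$ let $$\mathtt U_1^{(i)}(x,z)=\mathtt H\,\mathtt R_z(-b^i)\,\mathtt R_z(-a^i_{N+d}z_d)\cdots\mathtt R_z(-a^i_{N+1}z_1)\,\mathtt R_z(-a^i_Nx_N)\cdots\mathtt R_z(-a^i_1x_1)\,\mathtt H,\qquad \mathtt U_2^{(i)}=\mathtt R_y(\gamma^i).$$ Let $\mathtt U_\theta(x,z)\in\mathbb{C}^{2^{\mathfrak n}\times2^{\mathfrak n}}$ be the block diagonal matrix with the $4\times4$ blocks $\mathtt U_1^{(i)}(x,z)\otimes\mathtt U_2^{(i)}$, $i=1,\dots,n$, followed by an identity block. Let $\mathtt V$ be any unitary $2^{\mathfrak n}\times 2^{\mathfrak n}$ matrix with $\mathtt V|0\rangle^{\otimes\mathfrak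 n}=\frac1{\sqrt n}\sum_{i=0}^{n-1}|4i\rangle$. Let $\mathbb{P}_m^{n,\theta}(x,z)$ be the probability that measuring $\mathtt U_\theta(x,z)\mathtt V|0\rangle^{\otimes\mathfrak n}$ gives a state in $\{m,4+m,\dots,4(n-1)+m\}$. For $\theta=(\theta^1,\dots,\theta^N)\in\Theta^N$ the network (RQNN) is the system with state map $\bar F^{n,\theta}_R:\mathbb{R}^N\times\mathbb{R}^d\to\mathbb{R}^N$, $$\bar F^{n,\theta}_{R,j}(x,z)=R-2R\big[\mathbb{P}_1^{n,\theta^j}(x,z)+\mathbb{P}_2^{n,\theta^j}(x,z)\big],\qquad j=1,\dots,N.$$ **Theorem.** Let $R>0$, $\lambda\in(0,1)$, let $D_d\subset\mathbb{R}^d$ be compact, and let $M\ge R$ be such that $D_d\subset[-M,M]^d$. Let $F=(F_1,\dots,F_N):\mathbb{R}^N\times\mathbb{R}^d\to\mathbb{R}^N$ be continuously differentiable with $\|\nabla_xF(x,z)\|_2\le\lambda$ (spectral norm) for all $x\in\mathbb{R}^N$, $z\in D_d$. Assume that for $j=1,\dots,N$ and $i=1,\dots,N+d$ we have $F_j\in\mathcal{F}_R$,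 $\partial_iF_j\in\mathcal{F}$ and $\int\|\xi\|^4|\widehat{F_j}(\xi)|\,d\xi<\infty$. Let $B_N\subset\mathbb{R}^N$ be closed and non-empty with $F(B_N\times D_d)\subset B_N$ (for instance $B_N=\mathbb{R}^N$). With $I_{q,j}=\int\|\xi\|^q|\widehat{F_j}(\xi)|\,d\xi$ put $$C_j^\infty=2(\pi+1)\|\widehat{F_j}\|_1+(8\pi M+4\pi^2)(N+d)^{1/2}\|\widehat{F_j}\|_1^{1/2}I_{2,j}^{1/2}+16M\pi^2(N+d)\|\widehat{F_j}\|_1^{1/2}I_{4,j}^{1/2}.$$ Then the system of $F$ has the echo state property with states in $B_N$ and inputs in $D_d$; let $U^F$ be its filter. For every $n\in\mathbb{N}$ with $$n>n_0=N^2\,\frac{(\max_jC_j^\infty)^2}{(1-\lambda)^2}$$ there is $\theta\in\Theta^N$ such that, for every admissible $\mathtt V$, the RQNN with state map $\bar F^{n,\theta}_R$ has the echo state property with states in $\mathbb{R}^N$ and inputs in $D_d$, and its filter $\bar U$ satisfies $$\sup_{z\in(D_d)^{\mathbb{Z}_-}}\ \sup_{t\in\mathbb{Z}_-}\big\|U^F(z)_t-\bar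 U(z)_t\big\|\le\frac1{1-\lambda}\,\frac{\sqrt N\,\max_jC_j^\infty}{\sqrt n}.$$ Each of the $N$ circuits of this network acts on $\mathfrak n=\lceil\log_2(4n)\rceil$ qubits. -/

import Mathlib

open scoped FourierTransform Kronecker

noncomputable section

namespace RQNN

/-! ### Spaces, the Barron-type classes and the constants -/

/-- `ℝ^N × ℝ^d` with its Euclidean norm, inner product and Lebesgue measure: the first `N`
coordinates (the state) carry the indices `Sum.inl k`, the last `d` ones (the input) carry
the indices `Sum.inr k`. -/
abbrev JointSpace (N d : ℕ) : Type := EuclideanSpace ℝ (Fin N ⊕ Fin d)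

/-- The point `(x, z)` of `ℝ^N × ℝ^d`. -/
def joint {N d : ℕ} (x : EuclideanSpace ℝ (Fin N)) (z : EuclideanSpace ℝ (Fin d)) :
    JointSpace N d :=
  WithLp.toLp 2 (Sum.elim (fun k => x k) (fun k => z k))

/-- The Fourier transform `ξ ↦ ∫ exp(-2πi y·ξ) f(y) dy` of a real function. -/
def fourierTransform {N d : ℕ} (f : JointSpace N d → ℝ) : JointSpace N d → ℂ :=
  𝓕 (fun y : JointSpace N d => (f y : ℂ))

/-- The class of continuous integrable functions with integrable Fourier transform. -/
def BarronClass (N d : ℕ) : Set (JointSpace N d → ℝ) :=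
  {f | Continuous f ∧ MeasureTheory.Integrable f ∧
    MeasureTheory.Integrable (fourierTransform f)}

/-- The moment `∫ ‖ξ‖ ^ q |f̂(ξ)| dξ`. -/
def fourierMoment {N d : ℕ} (q : ℕ) (f : JointSpace N d → ℝ) : ℝ :=
  ∫ ξ, ‖ξ‖ ^ q * ‖fourierTransform f ξ‖

/-- The norm `‖f̂‖₁`. -/
def fourierNorm {N d : ℕ} (f : JointSpace N d → ℝ) : ℝ :=
  ∫ ξ, ‖fourierTransform f ξ‖

/-- The members of `BarronClass N d` with `‖f̂‖₁ ≤ R`. -/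
def BarronBall (N d : ℕ) (R : ℝ) : Set (JointSpace N d → ℝ) :=
  {f | f ∈ BarronClass N d ∧ fourierNorm f ≤ R}

/-- The partial derivative `∂_i f`, for a coordinate `i` of `ℝ^N × ℝ^d`. -/
def partialDeriv {N d : ℕ} (i : Fin N ⊕ Fin d) (f : JointSpace N d → ℝ) :
    JointSpace N d → ℝ :=
  fun w => fderiv ℝ f w (EuclideanSpace.single i 1)

/-- The constant `C^∞` of a function `f` at the box size `M`. -/
def constInfty {N d : ℕ} (M : ℝ) (f : JointSpace N d → ℝ) : ℝ :=
  2 * (Real.pi + 1) * fourierNorm f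
    + (8 * Real.pi * M + 4 * Real.pi ^ 2) * √((N : ℝ) + d) * √(fourierNorm f)
        * √(fourierMoment 2 f)
    + 16 * M * Real.pi ^ 2 * ((N : ℝ) + d) * √(fourierNorm f) * √(fourierMoment 4 f)

/-- `max_j C_j^∞` over the components of a state map (`0` for `N = 0`). -/
def maxConstInfty {N d : ℕ} (M : ℝ) (F : JointSpace N d → EuclideanSpace ℝ (Fin N)) : ℝ :=
  ⨆ j : Fin N, constInfty M (fun w => F w j)

/-! ### State-space systems on the non-positive integers -/

/-- The time set `{…, -2, -1, 0}`. -/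
abbrev NegTime : Type := {t : ℤ // t ≤ 0}

/-- The preceding time `t - 1`. -/
def NegTime.prev (t : NegTime) : NegTime := ⟨t.1 - 1, by have := t.2; omega⟩

/-- `x` solves `x_t = F(x_{t-1}, z_t)` for all `t ≤ 0`. -/
def IsSolution {N d : ℕ} (F : JointSpace N d → EuclideanSpace ℝ (Fin N))
    {B : Set (EuclideanSpace ℝ (Fin N))} {D : Set (EuclideanSpace ℝ (Fin d))}
    (z : NegTime → D) (x : NegTime → B) : Prop :=
  ∀ t : NegTime, (x t : EuclideanSpace ℝ (Fin N)) = F (joint (x t.prev) (z t))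

/-- The echo state property with states in `B` and inputs in `D`: for each input sequence
there is exactly one solution. -/
def EchoStateProperty {N d : ℕ} (F : JointSpace N d → EuclideanSpace ℝ (Fin N))
    (B : Set (EuclideanSpace ℝ (Fin N))) (D : Set (EuclideanSpace ℝ (Fin d))) : Prop :=
  ∀ z : NegTime → D, ∃! x : NegTime → B, IsSolution F z x

/-- The filter of a system with the echo state property: it sends an input sequence to the
unique solution. -/
def stateFilter {N d : ℕ} {F : JointSpace N d → EuclideanSpace ℝ (Fin N)}
    {B : Set (EuclideanSpace ℝ (Fin N))} {D : Set (EuclideanSpace ℝ (Fin d))}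
    (h : EchoStateProperty F B D) (z : NegTime → D) : NegTime → B :=
  (h z).choose

/-! ### The quantum circuit -/

/-- The rotation `R_y(γ)`. -/
def rotY (γ : ℝ) : Matrix (Fin 2) (Fin 2) ℂ :=
  !![(Real.cos (γ / 2) : ℂ), -(Real.sin (γ / 2) : ℂ);
     (Real.sin (γ / 2) : ℂ), (Real.cos (γ / 2) : ℂ)]

/-- The rotation `R_z(α)`. -/
def rotZ (α : ℝ) : Matrix (Fin 2) (Fin 2) ℂ :=
  !![Complex.exp (-(Complex.I * (α / 2))), 0; 0, Complex.exp (Complex.I * (α / 2))]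

/-- The Hadamard gate. -/
def hadamardGate : Matrix (Fin 2) (Fin 2) ℂ :=
  ((1 / √2 : ℝ) : ℂ) • !![1, 1; 1, -1]

/-- The parameters `(a^i, b^i, γ^i)`, `i = 1, …, n`, of one circuit. -/
abbrev CircuitParams (N d n : ℕ) : Type :=
  Fin n → JointSpace N d × ℝ × Set.Icc (0 : ℝ) (2 * Real.pi)

/-- The gate `U₁ = H R_z(-b) R_z(-a_{N+d} z_d) ⋯ R_z(-a_{N+1} z_1) R_z(-a_N x_N) ⋯
R_z(-a_1 x_1) H`. -/
def gateOne {N d : ℕ} (a : JointSpace N d) (b : ℝ)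
    (x : EuclideanSpace ℝ (Fin N)) (z : EuclideanSpace ℝ (Fin d)) :
    Matrix (Fin 2) (Fin 2) ℂ :=
  hadamardGate * rotZ (-b)
    * (List.ofFn fun k : Fin d => rotZ (-(a (Sum.inr k.rev) * z k.rev))).prod
    * (List.ofFn fun k : Fin N => rotZ (-(a (Sum.inl k.rev) * x k.rev))).prod
    * hadamardGate

/-- The two-qubit block `U₁ ⊗ U₂`, where `U₂ = R_y(γ)`; the basis vector `|p⟩ ⊗ |q⟩` has the
index `2p + q`. -/
def gateBlock {N d : ℕ} (p : JointSpace N d × ℝ × Set.Icc (0 : ℝ) (2 * Real.pi))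
    (x : EuclideanSpace ℝ (Fin N)) (z : EuclideanSpace ℝ (Fin d)) :
    Matrix (Fin 4) (Fin 4) ℂ :=
  Matrix.reindex finProdFinEquiv finProdFinEquiv (gateOne p.1 p.2.1 x z ⊗ₖ rotY p.2.2)

/-- The number of qubits: the least `q` with `4 n ≤ 2 ^ q`. -/
def numQubits (n : ℕ) : ℕ := Nat.clog 2 (4 * n)

/-- The gate `U`: the block diagonal matrix with the `4 × 4` blocks `U₁^i ⊗ U₂^i`,
`i = 1, …, n`, completed by an identity block to the size `2 ^ numQubits n`. -/
def gateU {N d n : ℕ} (θ : CircuitParams N d n)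
    (x : EuclideanSpace ℝ (Fin N)) (z : EuclideanSpace ℝ (Fin d)) :
    Matrix (Fin (2 ^ numQubits n)) (Fin (2 ^ numQubits n)) ℂ :=
  fun r c =>
    if h : (r : ℕ) / 4 < n then
      if (r : ℕ) / 4 = (c : ℕ) / 4 then
        gateBlock (θ ⟨(r : ℕ) / 4, h⟩) x z ⟨(r : ℕ) % 4, Nat.mod_lt _ (by norm_num)⟩
          ⟨(c : ℕ) % 4, Nat.mod_lt _ (by norm_num)⟩
      else 0
    else if r = c then 1 else 0

/-- The initial state `|0⟩ ⊗ ⋯ ⊗ |0⟩`. -/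
def initialState (n : ℕ) : Fin (2 ^ numQubits n) → ℂ :=
  fun r => if (r : ℕ) = 0 then 1 else 0

/-- The state `ψ = n^{-1/2} ∑_{i < n} |4 i⟩`. -/
def uniformState (n : ℕ) : Fin (2 ^ numQubits n) → ℂ :=
  fun r => if (r : ℕ) % 4 = 0 ∧ (r : ℕ) / 4 < n then ((1 / √(n : ℝ) : ℝ) : ℂ) else 0

/-- An admissible gate `V`: any unitary matrix mapping the initial state to `ψ`. -/
def IsPreparationGate (n : ℕ)
    (V : Matrix (Fin (2 ^ numQubits n)) (Fin (2 ^ numQubits n)) ℂ) : Prop :=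
  V ∈ Matrix.unitaryGroup (Fin (2 ^ numQubits n)) ℂ ∧
    V.mulVec (initialState n) = uniformState n

/-- Admissible gates `V` exist. -/
theorem exists_isPreparationGate (n : ℕ) (hn : 0 < n) : ∃ V, IsPreparationGate n V := by
  have hsize : 4 * n ≤ 2 ^ numQubits n := Nat.le_pow_clog (by norm_num) _
  let o : Fin (2 ^ numQubits n) := ⟨0, by positivity⟩
  have hinit : initialState n = Pi.single o 1 := by
    funext r
    simp only [initialState, Pi.single_apply, o, Fin.ext_iff]
  have hcount : (Finset.univ.filter fun r : Fin (2 ^ numQubits n) =>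
      (r : ℕ) % 4 = 0 ∧ (r : ℕ) / 4 < n).card = n := by
    have hinj : Function.Injective
        (fun i : Fin n => (⟨4 * i, by omega⟩ : Fin (2 ^ numQubits n))) := by
      intro i j hij
      simp only [Fin.mk.injEq] at hij
      ext
      omega
    have himage : (Finset.univ.filter fun r : Fin (2 ^ numQubits n) =>
        (r : ℕ) % 4 = 0 ∧ (r : ℕ) / 4 < n)
        = Finset.univ.image
          (fun i : Fin n => (⟨4 * i, by omega⟩ : Fin (2 ^ numQubits n))) := by
      ext r
      simp only [Finset.mem_filter, Finset.mem_univ, true_and, Finset.mem_image, Fin.ext_iff]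
      constructor
      · rintro ⟨h0, h1⟩
        exact ⟨⟨(r : ℕ) / 4, h1⟩, by simp only; omega⟩
      · rintro ⟨i, hi⟩
        have := i.2
        omega
    rw [himage, Finset.card_image_of_injective _ hinj, Finset.card_univ, Fintype.card_fin]
  let ψ : EuclideanSpace ℂ (Fin (2 ^ numQubits n)) := WithLp.toLp 2 (uniformState n)
  have hψ : ‖ψ‖ = 1 := by
    have hn' : (0 : ℝ) < n := by exact_mod_cast hn
    have hterm : ∀ r : Fin (2 ^ numQubits n), ‖ψ r‖ ^ 2 =
        if (r : ℕ) % 4 = 0 ∧ (r : ℕ) / 4 < n then (1 / n : ℝ) else 0 := by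
      intro r
      by_cases h : (r : ℕ) % 4 = 0 ∧ (r : ℕ) / 4 < n
      · simp [ψ, uniformState, h, Real.sq_sqrt hn'.le]
      · simp [ψ, uniformState, h]
    rw [EuclideanSpace.norm_eq, Finset.sum_congr rfl fun r _ => hterm r,
      ← Finset.sum_filter, Finset.sum_const, hcount]
    simp [hn'.ne']
  have hortho : Orthonormal ℂ (({o} : Set (Fin (2 ^ numQubits n))).domRestrict fun _ => ψ) := by
    refine ⟨fun _ => hψ, fun i j hij => (hij (Subsingleton.elim i j)).elim⟩
  obtain ⟨b, hb⟩ := hortho.exists_orthonormalBasis_extension_of_card_eq (by simp)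
  refine ⟨(EuclideanSpace.basisFun _ ℂ).toBasis.toMatrix b,
    OrthonormalBasis.toMatrix_orthonormalBasis_mem_unitary _ _, ?_⟩
  rw [hinit, Matrix.mulVec_single_one]
  funext r
  simp [Matrix.col, Module.Basis.toMatrix_apply, hb o rfl, ψ]

/-- The probability of measuring a state in `{m, 4 + m, …, 4 (n - 1) + m}` after the gates
`V` and `U` have been applied to the initial state. -/
def outputProb {N d n : ℕ} (V : Matrix (Fin (2 ^ numQubits n)) (Fin (2 ^ numQubits n)) ℂ)
    (θ : CircuitParams N d n) (m : Fin 4)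
    (x : EuclideanSpace ℝ (Fin N)) (z : EuclideanSpace ℝ (Fin d)) : ℝ :=
  ∑ r : Fin (2 ^ numQubits n),
    if (r : ℕ) % 4 = m ∧ (r : ℕ) / 4 < n then
      ‖((gateU θ x z * V).mulVec (initialState n)) r‖ ^ 2
    else 0

/-- The state map of the recurrent quantum neural network built from `N` parallel circuits:
the `j`-th component is `R - 2 R (P_1 + P_2)` for the parameters `θ j`. -/
def rqnnMap {N d n : ℕ} (R : ℝ)
    (V : Matrix (Fin (2 ^ numQubits n)) (Fin (2 ^ numQubits n)) ℂ)
    (θ : Fin N → CircuitParams N d n) (w : JointSpace N d) : EuclideanSpace ℝ (Fin N) :=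
  WithLp.toLp 2 fun j =>
    R - 2 * R *
      (outputProb V (θ j) 1 (WithLp.toLp 2 fun k => w (Sum.inl k))
          (WithLp.toLp 2 fun k => w (Sum.inr k))
        + outputProb V (θ j) 2 (WithLp.toLp 2 fun k => w (Sum.inl k))
          (WithLp.toLp 2 fun k => w (Sum.inr k)))

end RQNN

end

noncomputable section

namespace RQNN

open MeasureTheory

/-! ### The state map of the network in closed form -/

/-! Measuring the circuit turns it into a cosine network: component `j` equals `R / n * ∑ i, cos γ^i
* cos (b^i + ⟪a^i, w⟫)` (`rqnnMap_apply`), whatever the admissible gate `V`. Fourier inversion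
writes a target component `f` in the same shape (`eq_integral_cos`): with `A = ‖f̂‖₁ > 0`, `f w` is
the mean of `A * cos (arg f̂(ξ) + 2π ⟪ξ, w⟫)` when `ξ` has density `|f̂| / A`. Drawing `n`
independent frequencies gives a random network. Since `A ≤ R`, the amplitude is adjusted by a common
angle with `cos γ = A / R`.

The sampling error must be small uniformly on a ball containing the relevant states and inputs, and
so must its gradient. Symmetrization (`integral_norm_sum_sub_le`) reduces the mean uniform error to
Rademacher sums in a space of continuous functions. Because cosine is 1-Lipschitz, the comparison
principle (`exists_selection_le`) replaces the waves by linear functionals, whose Rademacher sums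
are bounded through orthogonality of signs. Partial derivatives of waves are waves again, so all
errors have mean of order `1 / √n`, and some single sample realizes the bound on their sum
(`exists_waveError_le`, `exists_circuit_approx`).

For `n > n₀` the derivative error is too small to destroy contractivity: the network contracts on
the cube `[-R, R]^N`, into which it maps everything in one step. This gives the echo state property
(`echoStateProperty_of_contracting`). The two filters are compared with the contraction rate of `F`
alone, so the one-step error is amplified by at most `1 / (1 - λ)` (`norm_sub_le_of_contracting`).
-/

theorem rotZ_zero : rotZ 0 = 1 := by
  ext i j
  fin_cases i <;> fin_cases j <;> simp [rotZ]

theorem rotZ_mul (α β : ℝ) : rotZ α * rotZ β = rotZ (α + β) := by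
  simp only [rotZ, Matrix.mul_fin_two, mul_zero, zero_mul, add_zero, zero_add, ← Complex.exp_add]
  push_cast
  congr 4 <;> ring_nf

theorem prod_ofFn_rotZ {m : ℕ} (u : Fin m → ℝ) :
    (List.ofFn fun k => rotZ (u k)).prod = rotZ (∑ k, u k) := by
  induction m with
  | zero => simp [rotZ_zero]
  | succ m ih => rw [List.ofFn_succ, List.prod_cons, ih, rotZ_mul, Fin.sum_univ_succ]

/-- The `z`-rotations form a one-parameter group, so their angles add up and the order of the
factors is irrelevant. -/
theorem gateOne_eq {N d : ℕ} (a : JointSpace N d) (b : ℝ)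
    (x : EuclideanSpace ℝ (Fin N)) (z : EuclideanSpace ℝ (Fin d)) :
    gateOne a b x z =
      hadamardGate * rotZ (-(b + inner ℝ a (joint x z))) * hadamardGate := by
  have h1 : ∀ {m : ℕ} (u : Fin m → ℝ), ∑ k : Fin m, u k.rev = ∑ k, u k := fun u =>
    Equiv.sum_comp Fin.revPerm u
  rw [gateOne, prod_ofFn_rotZ, prod_ofFn_rotZ, Matrix.mul_assoc hadamardGate,
    Matrix.mul_assoc hadamardGate, rotZ_mul, rotZ_mul,
    h1 fun k => -(a (Sum.inr k) * z k), h1 fun k => -(a (Sum.inl k) * x k)]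
  congr 3
  simp only [PiLp.inner_apply, Fintype.sum_sum_type, joint, Sum.elim_inl, Sum.elim_inr,
    Finset.sum_neg_distrib, RCLike.inner_apply, conj_trivial, mul_comm]
  ring

theorem hadamard_rotZ_hadamard (α : ℝ) :
    (hadamardGate * rotZ (-α) * hadamardGate) 0 0 = Complex.cos (α / 2) ∧
    (hadamardGate * rotZ (-α) * hadamardGate) 1 0 = Complex.I * Complex.sin (α / 2) := by
  have h2 : ((√2 : ℝ) : ℂ) ^ 2 = 2 := by
    rw [← Complex.ofReal_pow, Real.sq_sqrt (by norm_num)]; norm_num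
  have h0 : ((√2 : ℝ) : ℂ) ≠ 0 := by
    intro h; rw [h] at h2; norm_num at h2
  have hI := Complex.I_sq
  constructor
  · simp only [hadamardGate, rotZ, Matrix.smul_mul, Matrix.mul_smul, Matrix.mul_fin_two,
      Matrix.smul_apply, smul_eq_mul, Complex.cos]
    simp
    field_simp
    rw [h2]
  · simp only [hadamardGate, rotZ, Matrix.smul_mul, Matrix.mul_smul, Matrix.mul_fin_two,
      Matrix.smul_apply, smul_eq_mul, Complex.sin]
    simp
    field_simp
    rw [h2, hI]
    ring_nf

theorem normSq_gateOne {N d : ℕ} (a : JointSpace N d) (b : ℝ)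
    (x : EuclideanSpace ℝ (Fin N)) (z : EuclideanSpace ℝ (Fin d)) :
    ‖gateOne a b x z 0 0‖ ^ 2 = (1 + Real.cos (b + inner ℝ a (joint x z))) / 2 ∧
    ‖gateOne a b x z 1 0‖ ^ 2 = (1 - Real.cos (b + inner ℝ a (joint x z))) / 2 := by
  rw [gateOne_eq]
  set α := b + inner ℝ a (joint x z)
  have h := hadamard_rotZ_hadamard α
  have hc : Complex.cos (α / 2) = (Real.cos (α / 2) : ℝ) := by push_cast; rfl
  have hs : Complex.sin (α / 2) = (Real.sin (α / 2) : ℝ) := by push_cast; rfl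
  have hα : Real.cos α = 2 * Real.cos (α / 2) ^ 2 - 1 := by
    rw [← Real.cos_two_mul]; ring_nf
  have h1 := Real.sin_sq_add_cos_sq (α / 2)
  rw [h.1, h.2, hc, hs, norm_mul, Complex.norm_I, Complex.norm_real, Complex.norm_real, one_mul,
    Real.norm_eq_abs, Real.norm_eq_abs, sq_abs, sq_abs, hα]
  constructor <;> linarith

theorem gateBlock_apply_zero {N d : ℕ} (p : JointSpace N d × ℝ × Set.Icc (0 : ℝ) (2 * Real.pi))
    (x : EuclideanSpace ℝ (Fin N)) (z : EuclideanSpace ℝ (Fin d)) :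
    gateBlock p x z 1 0 = gateOne p.1 p.2.1 x z 0 0 * Real.sin (p.2.2 / 2) ∧
    gateBlock p x z 2 0 = gateOne p.1 p.2.1 x z 1 0 * Real.cos (p.2.2 / 2) :=
  ⟨rfl, rfl⟩

/-- Outcomes 1 and 2 are those where the two qubits disagree. The qubits are independent with mean
signs `cos α` and `cos γ`, so the mean of the product of signs is `cos α * cos γ`. -/
theorem normSq_gateBlock {N d : ℕ} (p : JointSpace N d × ℝ × Set.Icc (0 : ℝ) (2 * Real.pi))
    (x : EuclideanSpace ℝ (Fin N)) (z : EuclideanSpace ℝ (Fin d)) :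
    ‖gateBlock p x z 1 0‖ ^ 2 + ‖gateBlock p x z 2 0‖ ^ 2 =
      (1 - Real.cos p.2.2 * Real.cos (p.2.1 + inner ℝ p.1 (joint x z))) / 2 := by
  have h := gateBlock_apply_zero p x z
  have hα : Real.cos p.2.2 = 2 * Real.cos (p.2.2 / 2) ^ 2 - 1 := by
    rw [← Real.cos_two_mul]; ring_nf
  have h1 := Real.sin_sq (p.2.2 / 2 : ℝ)
  have hn := normSq_gateOne p.1 p.2.1 x z
  rw [h.1, h.2, norm_mul, norm_mul, mul_pow, mul_pow, hn.1, hn.2, Complex.norm_real,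
    Complex.norm_real, Real.norm_eq_abs, Real.norm_eq_abs, sq_abs, sq_abs, h1, hα]
  ring

theorem four_mul_add_lt {n : ℕ} (i : Fin n) (m : Fin 4) :
    4 * (i : ℕ) + m < 2 ^ numQubits n := by
  have : 4 * n ≤ 2 ^ numQubits n := Nat.le_pow_clog (by norm_num) _
  omega

/-- The uniform state lives on the first basis vector of each block, so only column 0 of each block
is seen. -/
theorem gateU_mulVec_uniformState {N d n : ℕ} (θ : CircuitParams N d n)
    (x : EuclideanSpace ℝ (Fin N)) (z : EuclideanSpace ℝ (Fin d)) (i : Fin n) (m : Fin 4) :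
    (gateU θ x z).mulVec (uniformState n) ⟨4 * i + m, four_mul_add_lt i m⟩ =
      gateBlock (θ i) x z m 0 * ((1 / √(n : ℝ) : ℝ) : ℂ) := by
  have hdiv : (4 * (i : ℕ) + m) / 4 = i := by omega
  have hmod : (4 * (i : ℕ) + m) % 4 = m := by omega
  rw [Matrix.mulVec, dotProduct,
    Finset.sum_eq_single (⟨4 * i + (0 : Fin 4), four_mul_add_lt i 0⟩ : Fin (2 ^ numQubits n))]
  · simp [gateU, uniformState, hdiv, hmod]
  · intro c _ hc
    simp only [gateU, uniformState, hdiv]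
    by_cases h : (c : ℕ) % 4 = 0 ∧ (c : ℕ) / 4 < n
    · have : (i : ℕ) ≠ (c : ℕ) / 4 := by
        intro hi
        apply hc
        ext
        simp
        omega
      simp [this]
    · rw [if_neg h, mul_zero]
  · simp

/-- Only the image of the initial state under `V` enters. This is why one choice of parameters
serves all admissible `V`. -/
theorem outputProb_eq {N d n : ℕ} {V : Matrix (Fin (2 ^ numQubits n)) (Fin (2 ^ numQubits n)) ℂ}
    (hV : IsPreparationGate n V) (θ : CircuitParams N d n) (m : Fin 4)
    (x : EuclideanSpace ℝ (Fin N)) (z : EuclideanSpace ℝ (Fin d)) :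
    outputProb V θ m x z = (∑ i, ‖gateBlock (θ i) x z m 0‖ ^ 2) / n := by
  have hinj : Function.Injective
      (fun i : Fin n => (⟨4 * i + m, four_mul_add_lt i m⟩ : Fin (2 ^ numQubits n))) := by
    intro i j hij
    simp only [Fin.mk.injEq] at hij
    ext
    omega
  have himage : (Finset.univ.filter fun r : Fin (2 ^ numQubits n) =>
      (r : ℕ) % 4 = m ∧ (r : ℕ) / 4 < n) = Finset.univ.image
        (fun i : Fin n => (⟨4 * i + m, four_mul_add_lt i m⟩ : Fin (2 ^ numQubits n))) := by
    ext r
    simp only [Finset.mem_filter, Finset.mem_univ, true_and, Finset.mem_image, Fin.ext_iff]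
    constructor
    · rintro ⟨h0, h1⟩
      exact ⟨⟨(r : ℕ) / 4, h1⟩, by simp only; omega⟩
    · rintro ⟨i, hi⟩
      have := i.2
      omega
  rw [outputProb, ← Matrix.mulVec_mulVec, hV.2, ← Finset.sum_filter, himage,
    Finset.sum_image hinj.injOn, Finset.sum_div]
  refine Finset.sum_congr rfl fun i _ => ?_
  rw [gateU_mulVec_uniformState, norm_mul, mul_pow, Complex.norm_real, Real.norm_eq_abs, sq_abs,
    div_pow, Real.sq_sqrt (Nat.cast_nonneg n), one_pow, mul_one_div]

theorem joint_eta {N d : ℕ} (w : JointSpace N d) :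
    joint (WithLp.toLp 2 fun k => w (Sum.inl k)) (WithLp.toLp 2 fun k => w (Sum.inr k)) = w := by
  ext (k | k) <;> rfl

/-- The network is a superposition of cosine waves. -/
theorem rqnnMap_apply {N d n : ℕ} (hn : 0 < n) (R : ℝ)
    {V : Matrix (Fin (2 ^ numQubits n)) (Fin (2 ^ numQubits n)) ℂ}
    (hV : IsPreparationGate n V) (θ : Fin N → CircuitParams N d n) (w : JointSpace N d)
    (j : Fin N) :
    rqnnMap R V θ w j = R / n * ∑ i, Real.cos (θ j i).2.2 *
      Real.cos ((θ j i).2.1 + inner ℝ (θ j i).1 w) := by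
  have hn' : (n : ℝ) ≠ 0 := by positivity
  simp only [rqnnMap]
  rw [outputProb_eq hV, outputProb_eq hV, ← add_div, ← Finset.sum_add_distrib]
  simp_rw [normSq_gateBlock, joint_eta]
  rw [← Finset.sum_div, Finset.sum_sub_distrib]
  simp
  field_simp
  ring

/-! ### Contractive systems -/

theorem stateFilter_isSolution {N d : ℕ} {F : JointSpace N d → EuclideanSpace ℝ (Fin N)}
    {B : Set (EuclideanSpace ℝ (Fin N))} {D : Set (EuclideanSpace ℝ (Fin d))}
    (h : EchoStateProperty F B D) (z : NegTime → D) : IsSolution F z (stateFilter h z) :=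
  (h z).choose_spec.1

/-- Two state trajectories with bounded distance whose distance contracts up to an error `ε`
in each time step are within distance `ε / (1 - c)`. -/
theorem norm_sub_le_of_contracting {E : Type*} [NormedAddCommGroup E] {c ε K : ℝ}
    (hc0 : 0 ≤ c) (hc1 : c < 1) {x y : NegTime → E} (hK : ∀ t, ‖x t - y t‖ ≤ K)
    (h : ∀ t, ‖x t - y t‖ ≤ c * ‖x t.prev - y t.prev‖ + ε) (t : NegTime) :
    ‖x t - y t‖ ≤ 1 / (1 - c) * ε := by
  have hc : 0 < 1 - c := by linarith
  -- `ε / (1 - c)` is the fixed point of `e ↦ c * e + ε`; subtracting it makes the recursion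
  -- homogeneous. The infinite past allows arbitrarily many steps back from `t`.
  have step : ∀ m : ℕ, ∀ t, ‖x t - y t‖ - 1 / (1 - c) * ε ≤ c ^ m * (K - 1 / (1 - c) * ε) := by
    intro m
    induction m with
    | zero => intro t; simpa using hK t
    | succ m ih =>
      intro t
      have h1 := mul_le_mul_of_nonneg_left (ih t.prev) hc0
      have h2 : c * (1 / (1 - c) * ε) + ε = 1 / (1 - c) * ε := by field_simp; ring
      rw [pow_succ']
      nlinarith [h t]
  have hlim : Filter.Tendsto (fun m : ℕ => c ^ m * (K - 1 / (1 - c) * ε)) Filter.atTop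
      (nhds (0 * (K - 1 / (1 - c) * ε))) :=
    (tendsto_pow_atTop_nhds_zero_of_lt_one hc0 hc1).mul_const _
  have := ge_of_tendsto' hlim fun m => step m t
  linarith

/-- A system whose state map sends `B × D` into a bounded closed set `S ⊆ B`, and is a uniform
contraction in the state variable on `S`, has the echo state property. -/
theorem echoStateProperty_of_contracting {N d : ℕ}
    {G : JointSpace N d → EuclideanSpace ℝ (Fin N)}
    {B S : Set (EuclideanSpace ℝ (Fin N))} {D : Set (EuclideanSpace ℝ (Fin d))}
    (hB : B.Nonempty) (hSB : S ⊆ B) (hS : IsClosed S) {K : ℝ} (hK : ∀ x ∈ S, ‖x‖ ≤ K)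
    (hmaps : ∀ x ∈ B, ∀ z ∈ D, G (joint x z) ∈ S) {c : ℝ} (hc0 : 0 ≤ c) (hc1 : c < 1)
    (hcontr : ∀ x ∈ S, ∀ y ∈ S, ∀ z ∈ D, ‖G (joint x z) - G (joint y z)‖ ≤ c * ‖x - y‖) :
    EchoStateProperty G B D := by
  intro z
  obtain ⟨b, hb⟩ := hB
  have hbound : ∀ x ∈ S, ∀ y ∈ S, ‖x - y‖ ≤ 2 * K := fun x hx y hy =>
    (norm_sub_le x y).trans (by linarith [hK x hx, hK y hy])
  let s0 : EuclideanSpace ℝ (Fin N) := G (joint b (z ⟨0, le_rfl⟩))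
  have hs0 : s0 ∈ S := hmaps b hb _ (z _).2
  -- Picard iteration on whole trajectories, started at a constant point of `S`, where the
  -- contraction estimate is available from the outset.
  obtain ⟨u, hu0, hu⟩ : ∃ u : ℕ → NegTime → EuclideanSpace ℝ (Fin N), (∀ t, u 0 t = s0) ∧
      ∀ m t, u (m + 1) t = G (joint (u m t.prev) (z t)) :=
    ⟨fun m => Nat.rec (fun _ => s0) (fun _ x t => G (joint (x t.prev) (z t))) m,
      fun _ => rfl, fun _ _ => rfl⟩
  have huS : ∀ m t, u m t ∈ S := by
    intro m
    induction m with
    | zero => exact fun t => by rw [hu0]; exact hs0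
    | succ m ih => exact fun t => by rw [hu]; exact hmaps _ (hSB (ih _)) _ (z t).2
  have hgeom : ∀ m t, dist (u m t) (u (m + 1) t) ≤ 2 * K * c ^ m := by
    intro m
    induction m with
    | zero =>
      intro t
      rw [pow_zero, mul_one, dist_eq_norm]
      exact hbound _ (huS _ _) _ (huS _ _)
    | succ m ih =>
      intro t
      rw [dist_eq_norm, hu, hu (m + 1)]
      refine (hcontr _ (huS _ _) _ (huS _ _) _ (z t).2).trans ?_
      have := ih t.prev
      rw [dist_eq_norm] at this
      rw [pow_succ']
      nlinarith
  have hlim : ∀ t, ∃ l, Filter.Tendsto (fun m => u m t) Filter.atTop (nhds l) := fun t =>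
    cauchySeq_tendsto_of_complete (cauchySeq_of_le_geometric c _ hc1 fun m => hgeom m t)
  choose l hl using hlim
  have hlS : ∀ t, l t ∈ S := fun t =>
    hS.mem_of_tendsto (hl t) (Filter.Eventually.of_forall fun m => huS m t)
  have hsol : ∀ t, l t = G (joint (l t.prev) (z t)) := by
    intro t
    refine tendsto_nhds_unique ((Filter.tendsto_add_atTop_iff_nat 1).2 (hl t)) ?_
    rw [tendsto_iff_norm_sub_tendsto_zero]
    simp_rw [hu]
    have h0 : Filter.Tendsto (fun m => c * ‖u m t.prev - l t.prev‖) Filter.atTop (nhds 0) := by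
      simpa using (tendsto_iff_norm_sub_tendsto_zero.1 (hl t.prev)).const_mul c
    exact squeeze_zero (fun _ => norm_nonneg _)
      (fun m => hcontr _ (huS m _) _ (hlS _) _ (z t).2) h0
  refine ⟨fun t => ⟨l t, hSB (hlS t)⟩, fun t => hsol t, ?_⟩
  intro y hy
  -- Every state of a solution in `B` is an image under `G`, hence lies in `S`; uniqueness then
  -- follows from contraction with zero error.
  have hyS : ∀ t, (y t : EuclideanSpace ℝ (Fin N)) ∈ S := fun t => by
    rw [hy t]
    exact hmaps _ (y _).2 _ (z t).2
  funext t
  have key := norm_sub_le_of_contracting (ε := 0) hc0 hc1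
    (x := fun t => (y t : EuclideanSpace ℝ (Fin N))) (y := l)
    (fun t => hbound _ (hyS t) _ (hlS t))
    (fun t => by
      have := hcontr _ (hyS t.prev) _ (hlS t.prev) _ (z t).2
      rwa [← hy t, ← hsol t, ← add_zero (c * _)] at this) t
  rw [mul_zero, norm_le_zero_iff, sub_eq_zero] at key
  exact Subtype.ext key

/-! ### Rademacher sums -/

/-- The real number `±1` given by a sign. -/
def sgn (s : ℤˣ) : ℝ := ((s : ℤ) : ℝ)

theorem sgn_cases (s : ℤˣ) : sgn s = 1 ∨ sgn s = -1 := by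
  rcases Int.units_eq_one_or s with h | h <;> simp [sgn, h]

theorem sgn_neg (s : ℤˣ) : sgn (-s) = -sgn s := by simp [sgn]

theorem sgn_mul_self (s : ℤˣ) : sgn s * sgn s = 1 := by
  rcases sgn_cases s with h | h <;> simp [h]

theorem card_signs (n : ℕ) : Fintype.card (Fin n → ℤˣ) = 2 ^ n := by
  simp [Fintype.card_units_int]

/-- Flipping one sign. -/
def flipSign {n : ℕ} (i : Fin n) (ε : Fin n → ℤˣ) : Fin n → ℤˣ :=
  Function.update ε i (-ε i)

theorem flipSign_involutive {n : ℕ} (i : Fin n) : Function.Involutive (flipSign i) := by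
  intro ε
  simp [flipSign]

theorem flipSign_self {n : ℕ} (i : Fin n) (ε : Fin n → ℤˣ) : flipSign i ε i = -ε i := by
  simp [flipSign]

theorem flipSign_ne {n : ℕ} {i j : Fin n} (h : j ≠ i) (ε : Fin n → ℤˣ) :
    flipSign i ε j = ε j := by
  simp [flipSign, h]

theorem sum_flipSign {n : ℕ} (i : Fin n) (g : (Fin n → ℤˣ) → ℝ) :
    ∑ ε, g (flipSign i ε) = ∑ ε, g ε :=
  Equiv.sum_comp (flipSign_involutive i).toPerm g

/-- For `i ≠ j`, flipping the sign at `i` permutes the sign patterns and negates the summand. -/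
theorem sum_sgn_mul_sgn {n : ℕ} (i j : Fin n) :
    ∑ ε : Fin n → ℤˣ, sgn (ε i) * sgn (ε j) = if i = j then 2 ^ n else 0 := by
  split_ifs with h
  · subst h
    simp [sgn_mul_self, Fintype.card_units_int]
  · have h1 := sum_flipSign i fun ε : Fin n → ℤˣ => sgn (ε i) * sgn (ε j)
    simp only [flipSign_self, flipSign_ne (Ne.symm h), sgn_neg, neg_mul,
      Finset.sum_neg_distrib] at h1
    linarith

theorem sum_norm_sq_rademacher {n : ℕ} {E : Type*} [NormedAddCommGroup E]
    [InnerProductSpace ℝ E] (v : Fin n → E) :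
    ∑ ε : Fin n → ℤˣ, ‖∑ i, sgn (ε i) • v i‖ ^ 2 = 2 ^ n * ∑ i, ‖v i‖ ^ 2 := by
  have h : ∀ ε : Fin n → ℤˣ, ‖∑ i, sgn (ε i) • v i‖ ^ 2 =
      ∑ i, ∑ j, sgn (ε i) * sgn (ε j) * inner ℝ (v i) (v j) := by
    intro ε
    rw [← real_inner_self_eq_norm_sq, sum_inner]
    refine Finset.sum_congr rfl fun i _ => ?_
    rw [inner_sum]
    refine Finset.sum_congr rfl fun j _ => ?_
    rw [real_inner_smul_left, real_inner_smul_right, mul_assoc]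
  simp_rw [h]
  rw [Finset.sum_comm, Finset.mul_sum]
  refine Finset.sum_congr rfl fun i _ => ?_
  rw [Finset.sum_comm]
  simp_rw [← Finset.sum_mul, sum_sgn_mul_sgn]
  simp

/-- Cauchy–Schwarz over the `2 ^ n` sign patterns, applied to the exact second moment. -/
theorem sum_norm_rademacher_le {n : ℕ} {E : Type*} [NormedAddCommGroup E]
    [InnerProductSpace ℝ E] (v : Fin n → E) :
    ∑ ε : Fin n → ℤˣ, ‖∑ i, sgn (ε i) • v i‖ ≤ 2 ^ n * √(∑ i, ‖v i‖ ^ 2) := by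
  have h := sq_sum_le_card_mul_sum_sq (s := (Finset.univ : Finset (Fin n → ℤˣ)))
    (f := fun ε => ‖∑ i, sgn (ε i) • v i‖)
  rw [sum_norm_sq_rademacher, Finset.card_univ, card_signs] at h
  have h2 : (0 : ℝ) ≤ ∑ i, ‖v i‖ ^ 2 := Finset.sum_nonneg fun _ _ => sq_nonneg _
  refine (sq_le_sq₀ (Finset.sum_nonneg fun _ _ => norm_nonneg _) (by positivity)).1 ?_
  rw [mul_pow, Real.sq_sqrt h2]
  push_cast at h
  linarith

/-- One step of the comparison principle: exchanging a single coordinate. -/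
theorem exists_selection_step {n : ℕ} {W : Type*} (i : Fin n)
    (ψ : (Fin n → ℤˣ) → W → ℝ) (hψ : ∀ ε, ψ (flipSign i ε) = ψ ε) (h l : W → ℝ)
    (hl : ∀ w w', |h w - h w'| ≤ |l w - l w'|) (τ : (Fin n → ℤˣ) → W) :
    ∃ σ : (Fin n → ℤˣ) → W, ∑ ε, (ψ ε (τ ε) + sgn (ε i) * h (τ ε)) ≤
      ∑ ε, (ψ ε (σ ε) + sgn (ε i) * l (σ ε)) := by
  classical
  have hinv : ∀ ε, flipSign i (flipSign i ε) = ε := flipSign_involutive i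
  -- Pair `ε` with its flip. `ψ` agrees on the pair, so its two selected points may be exchanged
  -- freely; the exchange is made exactly when it turns the signed difference of `l` into `|l -
  -- l'|`, which dominates the one of `h`. The test gives the same answer for both members of the
  -- pair.
  let σ : (Fin n → ℤˣ) → W := fun ε =>
    if 0 ≤ sgn (ε i) * (l (τ ε) - l (τ (flipSign i ε))) then τ ε else τ (flipSign i ε)
  refine ⟨σ, ?_⟩
  have hdouble : ∀ g : (Fin n → ℤˣ) → ℝ, ∑ ε, (g ε + g (flipSign i ε)) = 2 * ∑ ε, g ε := by
    intro g
    rw [Finset.sum_add_distrib, sum_flipSign i g, two_mul]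
  have hmain : ∑ ε, ((ψ ε (τ ε) + sgn (ε i) * h (τ ε)) +
      (ψ (flipSign i ε) (τ (flipSign i ε)) +
        sgn (flipSign i ε i) * h (τ (flipSign i ε)))) ≤
      ∑ ε, ((ψ ε (σ ε) + sgn (ε i) * l (σ ε)) +
      (ψ (flipSign i ε) (σ (flipSign i ε)) +
        sgn (flipSign i ε i) * l (σ (flipSign i ε)))) := by
    refine Finset.sum_le_sum fun ε _ => ?_
    have hL := abs_le.1 (hl (τ ε) (τ (flipSign i ε)))
    simp only [σ, hinv, flipSign_self, sgn_neg, hψ]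
    rcases sgn_cases (ε i) with hs | hs <;> rw [hs] <;>
    · rcases le_total (l (τ ε)) (l (τ (flipSign i ε))) with hle | hle
      · rw [abs_of_nonpos (by linarith)] at hL
        rcases hle.eq_or_lt with heq | hlt
        · simp [heq] at hL ⊢
          linarith
        · split_ifs <;> linarith
      · rw [abs_of_nonneg (by linarith)] at hL
        rcases hle.eq_or_lt with heq | hlt
        · simp [heq] at hL ⊢
          linarith
        · split_ifs <;> linarith
  rw [hdouble fun ε => ψ ε (τ ε) + sgn (ε i) * h (τ ε),
    hdouble fun ε => ψ ε (σ ε) + sgn (ε i) * l (σ ε)] at hmain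
  linarith

/-- Comparison principle for Rademacher sums, with selections in place of suprema. -/
theorem exists_selection_le {n : ℕ} {W : Type*} (h l : Fin n → W → ℝ)
    (hl : ∀ i w w', |h i w - h i w'| ≤ |l i w - l i w'|) (τ : (Fin n → ℤˣ) → W) :
    ∃ σ : (Fin n → ℤˣ) → W, ∑ ε, ∑ i, sgn (ε i) * h i (τ ε) ≤
      ∑ ε, ∑ i, sgn (ε i) * l i (σ ε) := by
  classical
  -- The functions `h i` are exchanged for `l i` one index at a time; the terms of the other indices
  -- play the role of `ψ`, being insensitive to the flipped sign.
  have key : ∀ s : Finset (Fin n), ∃ σ : (Fin n → ℤˣ) → W,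
      ∑ ε, ∑ i, sgn (ε i) * h i (τ ε) ≤
        ∑ ε, ∑ i, sgn (ε i) * (if i ∈ s then l i else h i) (σ ε) := by
    intro s
    induction s using Finset.induction_on with
    | empty => exact ⟨τ, by simp⟩
    | insert k s hk ih =>
      obtain ⟨σ, hσ⟩ := ih
      obtain ⟨ρ, hρ⟩ := exists_selection_step k
        (fun ε w => ∑ i ∈ Finset.univ.erase k, sgn (ε i) * (if i ∈ s then l i else h i) w)
        (fun ε => by
          funext w
          exact Finset.sum_congr rfl fun i hi => by rw [flipSign_ne (Finset.ne_of_mem_erase hi)])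
        (h k) (l k) (hl k) σ
      refine ⟨ρ, hσ.trans ?_⟩
      refine (le_of_eq (Finset.sum_congr rfl fun ε _ => ?_)).trans
        (hρ.trans (le_of_eq (Finset.sum_congr rfl fun ε _ => ?_)))
      · rw [← Finset.sum_erase_add _ _ (Finset.mem_univ k), if_neg hk]
      · rw [← Finset.sum_erase_add _ (fun i => sgn (ε i) * (if i ∈ insert k s then l i else h i) _)
          (Finset.mem_univ k), if_pos (Finset.mem_insert_self _ _)]
        congr 1
        refine Finset.sum_congr rfl fun i hi => ?_
        simp [Finset.mem_insert, Finset.ne_of_mem_erase hi]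
  obtain ⟨σ, hσ⟩ := key Finset.univ
  exact ⟨σ, by simpa using hσ⟩

/-- Rademacher averages in `C(K, ℝ)`, `K` a ball, of functions that are dominated by linear
functionals. -/
theorem sum_norm_rademacher_continuousMap_le {n : ℕ} {E : Type*} [NormedAddCommGroup E]
    [InnerProductSpace ℝ E] [ProperSpace E] {r : ℝ} (hr : 0 ≤ r)
    (X : Fin n → C(Metric.closedBall (0 : E) r, ℝ)) (v : Fin n → E)
    (hX : ∀ i w w', |X i w - X i w'| ≤ |inner ℝ (v i) ((w : E) - w')|) :
    ∑ ε : Fin n → ℤˣ, ‖∑ i, sgn (ε i) • X i‖ ≤ 2 ^ n *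
      (√(∑ i, X i ⟨0, by simpa using hr⟩ ^ 2) + 2 * (r * √(∑ i, ‖v i‖ ^ 2))) := by
  set o : Metric.closedBall (0 : E) r := ⟨0, by simpa using hr⟩ with ho
  let h : Fin n → Metric.closedBall (0 : E) r → ℝ := fun i w => X i w - X i o
  let l : Fin n → Metric.closedBall (0 : E) r → ℝ := fun i w => inner ℝ (v i) (w : E)
  have hl : ∀ i w w', |h i w - h i w'| ≤ |l i w - l i w'| := by
    intro i w w'
    simp only [h, l, ← inner_sub_right, sub_sub_sub_cancel_right]
    exact hX i w w'
  have hsel : ∀ τ : (Fin n → ℤˣ) → Metric.closedBall (0 : E) r,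
      ∑ ε, ∑ i, sgn (ε i) * h i (τ ε) ≤ 2 ^ n * (r * √(∑ i, ‖v i‖ ^ 2)) := by
    intro τ
    obtain ⟨σ, hσ⟩ := exists_selection_le h l hl τ
    refine hσ.trans ?_
    calc ∑ ε, ∑ i, sgn (ε i) * l i (σ ε)
        ≤ ∑ ε : Fin n → ℤˣ, r * ‖∑ i, sgn (ε i) • v i‖ := by
          refine Finset.sum_le_sum fun ε _ => ?_
          have h1 : ∑ i, sgn (ε i) * l i (σ ε) =
              inner ℝ (∑ i, sgn (ε i) • v i) (σ ε : E) := by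
            rw [sum_inner]
            exact Finset.sum_congr rfl fun i _ => (real_inner_smul_left _ _ _).symm
          rw [h1, mul_comm]
          refine (real_inner_le_norm _ _).trans ?_
          exact mul_le_mul_of_nonneg_left (mem_closedBall_zero_iff.1 (σ ε).2) (norm_nonneg _)
      _ ≤ r * (2 ^ n * √(∑ i, ‖v i‖ ^ 2)) := by
          rw [← Finset.mul_sum]
          exact mul_le_mul_of_nonneg_left (sum_norm_rademacher_le v) hr
      _ = _ := by ring
  -- The norm is attained at a point by compactness. The absolute value there is handled by `p` if
  -- the centred sum is nonnegative and by `q` with reversed signs otherwise, the idle point being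
  -- the origin, where `h` vanishes. The two selections cause the factor 2.
  have hex : ∀ ε : Fin n → ℤˣ, ∃ p q : Metric.closedBall (0 : E) r,
      ‖∑ i, sgn (ε i) • X i‖ ≤ ‖∑ i, sgn (ε i) • X i o‖ +
        (∑ i, sgn (ε i) * h i p + ∑ i, sgn ((-ε) i) * h i q) := by
    intro ε
    have : Nonempty (Metric.closedBall (0 : E) r) := ⟨o⟩
    set S := ∑ i, sgn (ε i) • X i with hS
    obtain ⟨w, -, hw⟩ := isCompact_univ.exists_isMaxOn (Set.univ_nonempty)
      (f := fun w => ‖S w‖) (by fun_prop)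
    have hnorm : ‖S‖ ≤ ‖S w‖ :=
      (ContinuousMap.norm_le _ (norm_nonneg _)).2 fun x => hw (Set.mem_univ x)
    have heval : S w = ∑ i, sgn (ε i) • X i o + ∑ i, sgn (ε i) * h i w := by
      simp only [hS, h, ContinuousMap.coe_sum, Finset.sum_apply, ContinuousMap.smul_apply,
        smul_eq_mul, ← Finset.sum_add_distrib]
      exact Finset.sum_congr rfl fun i _ => by ring
    have ho0 : ∀ δ : Fin n → ℤˣ, ∑ i, sgn (δ i) * h i o = 0 := fun δ => by simp [h]
    have hneg : ∑ i, sgn ((-ε) i) * h i w = -∑ i, sgn (ε i) * h i w := by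
      simp [sgn_neg]
    have htri : ‖S w‖ ≤ ‖∑ i, sgn (ε i) • X i o‖ + |∑ i, sgn (ε i) * h i w| := by
      rw [heval]
      exact norm_add_le _ _
    rcases le_total 0 (∑ i, sgn (ε i) * h i w) with hs | hs
    · refine ⟨w, o, ?_⟩
      rw [ho0, add_zero]
      rw [abs_of_nonneg hs] at htri
      linarith
    · refine ⟨o, w, ?_⟩
      rw [ho0, hneg, zero_add]
      rw [abs_of_nonpos hs] at htri
      linarith
  choose p q hpq using hex
  have hq : ∑ ε : Fin n → ℤˣ, ∑ i, sgn ((-ε) i) * h i (q ε) ≤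
      2 ^ n * (r * √(∑ i, ‖v i‖ ^ 2)) := by
    rw [← Equiv.sum_comp (Equiv.neg (Fin n → ℤˣ))]
    simpa using hsel fun ε => q (-ε)
  have h0 := sum_norm_rademacher_le fun i => X i o
  simp only [Real.norm_eq_abs, sq_abs] at h0
  calc ∑ ε : Fin n → ℤˣ, ‖∑ i, sgn (ε i) • X i‖
      ≤ ∑ ε : Fin n → ℤˣ, (‖∑ i, sgn (ε i) • X i o‖ +
        (∑ i, sgn (ε i) * h i (p ε) + ∑ i, sgn ((-ε) i) * h i (q ε))) :=
        Finset.sum_le_sum fun ε _ => hpq ε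
    _ ≤ _ := by
        rw [Finset.sum_add_distrib, Finset.sum_add_distrib]
        simp only [Real.norm_eq_abs]
        linarith [hsel p]

/-! ### Symmetrization -/

theorem integral_comp_of_measurePreserving {α β V : Type*} [MeasurableSpace α]
    [MeasurableSpace β] [NormedAddCommGroup V] [NormedSpace ℝ V] {μ : Measure α} {ν : Measure β}
    {φ : α → β} (h : MeasurePreserving φ μ ν) {g : β → V} (hg : AEStronglyMeasurable g ν) :
    ∫ a, g (φ a) ∂μ = ∫ b, g b ∂ν := by
  rw [← h.map_eq] at hg ⊢
  exact (integral_map h.aemeasurable hg).symm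

/-- The sampling error of an empirical mean in a Banach space is at most twice the mean norm of
the signed sum. -/
theorem integral_norm_sum_sub_le {Ω V : Type*} [MeasurableSpace Ω] [NormedAddCommGroup V]
    [NormedSpace ℝ V] [CompleteSpace V] {μ : Measure Ω} [IsProbabilityMeasure μ] {X : Ω → V}
    (hX : Integrable X μ) {n : ℕ} (ε : Fin n → ℤˣ) :
    ∫ ω, ‖∑ i, (X (ω i) - ∫ a, X a ∂μ)‖ ∂(Measure.pi fun _ : Fin n => μ) ≤
      2 * ∫ ω, ‖∑ i, sgn (ε i) • X (ω i)‖ ∂(Measure.pi fun _ : Fin n => μ) := by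
  set P := Measure.pi fun _ : Fin n => μ with hP
  set Q := Measure.pi fun _ : Fin n => μ.prod μ with hQ
  have hXP : ∀ i, Integrable (fun ω : Fin n → Ω => X (ω i)) P := fun i => integrable_comp_eval hX
  have hEX : ∀ i, ∫ ω : Fin n → Ω, X (ω i) ∂P = ∫ a, X a ∂μ := fun i =>
    integral_comp_of_measurePreserving (measurePreserving_eval (fun _ : Fin n => μ) i)
      hX.aestronglyMeasurable
  have hdiff : Integrable (fun p : (Fin n → Ω) × (Fin n → Ω) => ∑ i, (X (p.1 i) - X (p.2 i)))
      (P.prod P) :=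
    integrable_finsetSum _ fun i _ => ((hXP i).comp_fst P).sub ((hXP i).comp_snd P)
  -- The expectation is replaced by the average over an independent copy of the sample, and the norm
  -- is moved inside the integral.
  have h1 : ∀ ω : Fin n → Ω, ‖∑ i, (X (ω i) - ∫ a, X a ∂μ)‖ ≤
      ∫ ω' : Fin n → Ω, ‖∑ i, (X (ω i) - X (ω' i))‖ ∂P := by
    intro ω
    have : ∑ i, (X (ω i) - ∫ a, X a ∂μ) = ∫ ω' : Fin n → Ω, ∑ i, (X (ω i) - X (ω' i)) ∂P := by
      have hd : ∀ i, Integrable (fun ω' : Fin n → Ω => X (ω i) - X (ω' i)) P := fun i =>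
        (integrable_const _).sub (hXP i)
      rw [integral_finsetSum _ fun i _ => hd i]
      refine Finset.sum_congr rfl fun i _ => ?_
      rw [integral_sub (integrable_const _) (hXP i), hEX]
      simp
    rw [this]
    exact norm_integral_le_integral_norm _
  have hfst : MeasurePreserving (fun (q : Fin n → Ω × Ω) i => (q i).1) Q P :=
    measurePreserving_pi _ _ fun _ => measurePreserving_fst
  have hsnd : MeasurePreserving (fun (q : Fin n → Ω × Ω) i => (q i).2) Q P :=
    measurePreserving_pi _ _ fun _ => measurePreserving_snd
  have hS : Integrable (fun ω : Fin n → Ω => ‖∑ i, sgn (ε i) • X (ω i)‖) P :=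
    (integrable_finsetSum _ fun i _ => (hXP i).smul (sgn (ε i))).norm
  have hXQ1 : ∀ i, Integrable (fun q : Fin n → Ω × Ω => X (q i).1) Q := fun i =>
    hfst.integrable_comp_of_integrable (hXP i)
  have hXQ2 : ∀ i, Integrable (fun q : Fin n → Ω × Ω => X (q i).2) Q := fun i =>
    hsnd.integrable_comp_of_integrable (hXP i)
  have hQdiff : Integrable (fun q : Fin n → Ω × Ω => ‖∑ i, (X (q i).1 - X (q i).2)‖) Q :=
    (integrable_finsetSum _ fun i _ => (hXQ1 i).sub (hXQ2 i)).norm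
  have hS1 : Integrable (fun q : Fin n → Ω × Ω => ‖∑ i, sgn (ε i) • X (q i).1‖) Q :=
    hfst.integrable_comp_of_integrable hS
  have hS2 : Integrable (fun q : Fin n → Ω × Ω => ‖∑ i, sgn (ε i) • X (q i).2‖) Q :=
    hsnd.integrable_comp_of_integrable hS
  -- Exchanging a sample point with its copy preserves the law and changes the sign of their
  -- difference, so any fixed signs can be inserted.
  have hflip : MeasurePreserving
      (fun (q : Fin n → Ω × Ω) i => if ε i = 1 then q i else (q i).swap) Q Q := by
    refine measurePreserving_pi _ _ (f := fun i (a : Ω × Ω) => if ε i = 1 then a else a.swap) fun i => ?_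
    by_cases h : ε i = 1
    · simp only [h, if_true]
      exact MeasurePreserving.id (μ.prod μ)
    · simpa [h] using Measure.measurePreserving_swap (μ := μ) (ν := μ)
  calc ∫ ω, ‖∑ i, (X (ω i) - ∫ a, X a ∂μ)‖ ∂P
      ≤ ∫ ω, ∫ ω' : Fin n → Ω, ‖∑ i, (X (ω i) - X (ω' i))‖ ∂P ∂P :=
        integral_mono (integrable_finsetSum _ fun i _ => (hXP i).sub (integrable_const _)).norm
          hdiff.norm.integral_prod_left h1
    _ = ∫ p : (Fin n → Ω) × (Fin n → Ω), ‖∑ i, (X (p.1 i) - X (p.2 i))‖ ∂(P.prod P) :=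
        (integral_prod _ hdiff.norm).symm
    _ = ∫ q : Fin n → Ω × Ω, ‖∑ i, (X (q i).1 - X (q i).2)‖ ∂Q :=
        (integral_comp_of_measurePreserving
          (measurePreserving_arrowProdEquivProdArrow Ω Ω (Fin n) (fun _ => μ) (fun _ => μ))
          hdiff.norm.aestronglyMeasurable).symm
    _ = ∫ q : Fin n → Ω × Ω, ‖∑ i, sgn (ε i) • (X (q i).1 - X (q i).2)‖ ∂Q := by
        rw [← integral_comp_of_measurePreserving hflip hQdiff.aestronglyMeasurable]
        refine integral_congr_ae (Filter.Eventually.of_forall fun q => ?_)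
        simp only
        congr 1
        refine Finset.sum_congr rfl fun i _ => ?_
        rcases Int.units_eq_one_or (ε i) with h | h <;> simp [h, sgn]
    _ ≤ ∫ q : Fin n → Ω × Ω, (‖∑ i, sgn (ε i) • X (q i).1‖ + ‖∑ i, sgn (ε i) • X (q i).2‖) ∂Q := by
        refine integral_mono (integrable_finsetSum _ fun i _ =>
          ((hXQ1 i).sub (hXQ2 i)).smul (sgn (ε i))).norm (hS1.add hS2) fun q => ?_
        simp only [smul_sub, Finset.sum_sub_distrib]
        exact norm_sub_le _ _
    _ = _ := by
        rw [integral_add hS1 hS2,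
          integral_comp_of_measurePreserving hfst hS.aestronglyMeasurable,
          integral_comp_of_measurePreserving hsnd hS.aestronglyMeasurable, two_mul]

/-- Jensen's inequality for the concave square root. -/
theorem integral_sqrt_sum_le {Ω : Type*} [MeasurableSpace Ω] {μ : Measure Ω}
    [IsProbabilityMeasure μ] {q : Ω → ℝ} (hq0 : ∀ a, 0 ≤ q a) (hq : Integrable q μ) (n : ℕ) :
    Integrable (fun ω : Fin n → Ω => √(∑ i, q (ω i))) (Measure.pi fun _ : Fin n => μ) ∧
    ∫ ω, √(∑ i, q (ω i)) ∂(Measure.pi fun _ : Fin n => μ) ≤ √n * √(∫ a, q a ∂μ) := by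
  set P := Measure.pi fun _ : Fin n => μ with hP
  have hqP : ∀ i, Integrable (fun ω : Fin n → Ω => q (ω i)) P := fun i => integrable_comp_eval hq
  have hs : Integrable (fun ω : Fin n → Ω => ∑ i, q (ω i)) P :=
    integrable_finsetSum _ fun i _ => hqP i
  have h0 : ∀ ω : Fin n → Ω, 0 ≤ ∑ i, q (ω i) := fun ω => Finset.sum_nonneg fun i _ => hq0 _
  have hi : Integrable (fun ω : Fin n → Ω => √(∑ i, q (ω i))) P := by
    refine (hs.add (integrable_const 1)).mono'
      (Real.continuous_sqrt.comp_aestronglyMeasurable hs.aestronglyMeasurable)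
      (Filter.Eventually.of_forall fun ω => ?_)
    rw [Real.norm_of_nonneg (Real.sqrt_nonneg _)]
    change _ ≤ ∑ i, q (ω i) + 1
    nlinarith [Real.sq_sqrt (h0 ω), sq_nonneg (√(∑ i, q (ω i)) - 1), h0 ω]
  refine ⟨hi, ?_⟩
  have hJ := Real.strictConcaveOn_sqrt.concaveOn.le_map_integral
    Real.continuous_sqrt.continuousOn isClosed_Ici (Filter.Eventually.of_forall h0) hs hi
  refine hJ.trans (le_of_eq ?_)
  rw [integral_finsetSum _ fun i _ => hqP i, ← Real.sqrt_mul (Nat.cast_nonneg n)]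
  congr 1
  rw [Finset.sum_congr rfl fun i _ => integral_comp_of_measurePreserving
    (measurePreserving_eval (fun _ : Fin n => μ) i) hq.aestronglyMeasurable]
  simp

/-- The mean uniform sampling error on a ball for functions dominated by linear functionals. -/
theorem integral_norm_mean_sub_le {Ω E : Type*} [MeasurableSpace Ω] [NormedAddCommGroup E]
    [InnerProductSpace ℝ E] [ProperSpace E] {r : ℝ} (hr : 0 ≤ r) {μ : Measure Ω}
    [IsProbabilityMeasure μ] {X : Ω → C(Metric.closedBall (0 : E) r, ℝ)} (hX : Integrable X μ)
    {v : Ω → E} (hXv : ∀ a w w', |X a w - X a w'| ≤ |inner ℝ (v a) ((w : E) - w')|)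
    (hX0 : Integrable (fun a => X a ⟨0, by simpa using hr⟩ ^ 2) μ)
    (hv : Integrable (fun a => ‖v a‖ ^ 2) μ) {n : ℕ} (hn : 0 < n) :
    ∫ ω, ‖(n : ℝ)⁻¹ • ∑ i, X (ω i) - ∫ a, X a ∂μ‖ ∂(Measure.pi fun _ : Fin n => μ) ≤
      2 / √n * (√(∫ a, X a ⟨0, by simpa using hr⟩ ^ 2 ∂μ) +
        2 * (r * √(∫ a, ‖v a‖ ^ 2 ∂μ))) := by
  set P := Measure.pi fun _ : Fin n => μ with hP
  set o : Metric.closedBall (0 : E) r := ⟨0, by simpa using hr⟩ with ho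
  have hn' : (0 : ℝ) < n := by exact_mod_cast hn
  have hXP : ∀ i, Integrable (fun ω : Fin n → Ω => X (ω i)) P := fun i => integrable_comp_eval hX
  have hS : ∀ ε : Fin n → ℤˣ, Integrable (fun ω : Fin n → Ω => ‖∑ i, sgn (ε i) • X (ω i)‖) P :=
    fun ε => (integrable_finsetSum _ fun i _ => (hXP i).smul (sgn (ε i))).norm
  obtain ⟨hκi, hκ⟩ := integral_sqrt_sum_le (fun a => sq_nonneg _) hX0 n
  obtain ⟨hvi, hv⟩ := integral_sqrt_sum_le (fun a => sq_nonneg _) hv n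
  set I := ∫ ω, ‖∑ i, (X (ω i) - ∫ a, X a ∂μ)‖ ∂P with hI
  have h1 : 2 ^ n * I ≤ 2 * (2 ^ n * (√n * √(∫ a, X a o ^ 2 ∂μ) +
      2 * (r * (√n * √(∫ a, ‖v a‖ ^ 2 ∂μ))))) := by
    -- Symmetrization holds for each fixed sign pattern; summing over all of them makes the
    -- Rademacher bound applicable for every fixed sample.
    calc 2 ^ n * I = ∑ ε : Fin n → ℤˣ, I := by
          rw [Finset.sum_const, Finset.card_univ, card_signs, nsmul_eq_mul]; push_cast; rfl
      _ ≤ ∑ ε : Fin n → ℤˣ, 2 * ∫ ω, ‖∑ i, sgn (ε i) • X (ω i)‖ ∂P :=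
          Finset.sum_le_sum fun ε _ => integral_norm_sum_sub_le hX ε
      _ = 2 * ∫ ω, ∑ ε : Fin n → ℤˣ, ‖∑ i, sgn (ε i) • X (ω i)‖ ∂P := by
          rw [← Finset.mul_sum, integral_finsetSum _ fun ε _ => hS ε]
      _ ≤ 2 * ∫ ω, 2 ^ n * (√(∑ i, X (ω i) o ^ 2) + 2 * (r * √(∑ i, ‖v (ω i)‖ ^ 2))) ∂P := by
          refine mul_le_mul_of_nonneg_left ?_ (by norm_num)
          exact integral_mono (integrable_finsetSum _ fun ε _ => hS ε)
            ((hκi.add ((hvi.const_mul r).const_mul 2)).const_mul _) fun ω =>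
            sum_norm_rademacher_continuousMap_le hr (fun i => X (ω i)) (fun i => v (ω i))
              fun i => hXv (ω i)
      _ ≤ _ := by
          rw [integral_const_mul, integral_add hκi ((hvi.const_mul r).const_mul 2),
            integral_const_mul, integral_const_mul]
          gcongr
  have h2 : I ≤ 2 * √n * (√(∫ a, X a o ^ 2 ∂μ) + 2 * (r * √(∫ a, ‖v a‖ ^ 2 ∂μ))) := by
    refine le_of_mul_le_mul_left (h1.trans (le_of_eq (by ring))) (by positivity : (0 : ℝ) < 2 ^ n)
  have h3 : ∀ ω : Fin n → Ω, ‖(n : ℝ)⁻¹ • ∑ i, X (ω i) - ∫ a, X a ∂μ‖ =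
      (n : ℝ)⁻¹ * ‖∑ i, (X (ω i) - ∫ a, X a ∂μ)‖ := by
    intro ω
    rw [Finset.sum_sub_distrib, Finset.sum_const, Finset.card_univ, Fintype.card_fin,
      ← Nat.cast_smul_eq_nsmul ℝ]
    nth_rw 2 [← Real.norm_of_nonneg (inv_nonneg.2 hn'.le)]
    rw [← norm_smul, smul_sub, inv_smul_smul₀ hn'.ne']
  simp_rw [h3]
  rw [integral_const_mul]
  refine (mul_le_mul_of_nonneg_left h2 (inv_nonneg.2 hn'.le)).trans (le_of_eq ?_)
  have hsn : √(n : ℝ) * √n = n := Real.mul_self_sqrt hn'.le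
  have hs0 : √(n : ℝ) ≠ 0 := (Real.sqrt_pos.2 hn').ne'
  rw [← mul_assoc]
  congr 1
  field_simp
  linarith

/-! ### Random cosine features -/

/-- The wave `w ↦ c cos (b + 2π ⟪ξ, w⟫)` on a ball. -/
def wave {E : Type*} [NormedAddCommGroup E] [InnerProductSpace ℝ E] (r : ℝ) (c b : ℝ) (ξ : E) :
    C(Metric.closedBall (0 : E) r, ℝ) where
  toFun w := c * Real.cos (b + 2 * Real.pi * inner ℝ ξ (w : E))
  continuous_toFun := by fun_prop

theorem wave_apply {E : Type*} [NormedAddCommGroup E] [InnerProductSpace ℝ E] (r : ℝ) (c b : ℝ)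
    (ξ : E) (w : Metric.closedBall (0 : E) r) :
    wave r c b ξ w = c * Real.cos (b + 2 * Real.pi * inner ℝ ξ (w : E)) := rfl

theorem continuous_wave_one {E : Type*} [NormedAddCommGroup E] [InnerProductSpace ℝ E]
    (r b : ℝ) : Continuous fun ξ : E => wave r 1 b ξ := by
  let g : C(E × Metric.closedBall (0 : E) r, ℝ) :=
    ⟨fun p => 1 * Real.cos (b + 2 * Real.pi * inner ℝ p.1 (p.2 : E)), by fun_prop⟩
  exact g.curry.continuous

/-- The phase will be `arg f̂(ξ)`, only measurable in `ξ`. The addition theorem moves it into scalar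
factors, leaving function-valued maps continuous in `ξ`; this gives strong measurability in the
uniform norm. -/
theorem wave_eq {E : Type*} [NormedAddCommGroup E] [InnerProductSpace ℝ E] (r c b : ℝ) (ξ : E) :
    wave r c b ξ = (c * Real.cos b) • wave r 1 0 ξ +
      (c * Real.sin b) • wave r 1 (Real.pi / 2) ξ := by
  ext w
  simp only [ContinuousMap.add_apply, ContinuousMap.smul_apply, wave_apply, smul_eq_mul,
    Real.cos_add, Real.cos_pi_div_two, Real.sin_pi_div_two, Real.cos_zero, Real.sin_zero]
  ring

theorem norm_wave_le {E : Type*} [NormedAddCommGroup E] [InnerProductSpace ℝ E]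
    [ProperSpace E] (r c b : ℝ) (ξ : E) : ‖wave r c b ξ‖ ≤ |c| := by
  refine (ContinuousMap.norm_le _ (abs_nonneg c)).2 fun w => ?_
  rw [wave_apply, Real.norm_eq_abs, abs_mul]
  exact mul_le_of_le_one_right (abs_nonneg c) (Real.abs_cos_le_one _)

section

theorem integrable_of_sq {Ω : Type*} [MeasurableSpace Ω] {μ : Measure Ω} [IsProbabilityMeasure μ]
    {c : Ω → ℝ} (hc : Measurable c) (hc2 : Integrable (fun ξ => c ξ ^ 2) μ) :
    Integrable c μ := by
  refine (hc2.add (integrable_const 1)).mono' hc.aestronglyMeasurable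
    (Filter.Eventually.of_forall fun ξ => ?_)
  change |c ξ| ≤ c ξ ^ 2 + 1
  rw [← sq_abs]
  nlinarith [sq_nonneg (|c ξ| - 1), abs_nonneg (c ξ)]

variable {ι : Type*} [Fintype ι] {μ : Measure (EuclideanSpace ℝ ι)} [IsProbabilityMeasure μ]
  {c b : EuclideanSpace ℝ ι → ℝ}

theorem integrable_wave (r : ℝ) (hc : Measurable c) (hb : Measurable b)
    (hc2 : Integrable (fun ξ => c ξ ^ 2) μ) :
    Integrable (fun ξ => wave r (c ξ) (b ξ) ξ) μ := by
  have hm : AEStronglyMeasurable (fun ξ => wave r (c ξ) (b ξ) ξ) μ := by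
    have h : (fun ξ => wave r (c ξ) (b ξ) ξ) = fun ξ => (c ξ * Real.cos (b ξ)) • wave r 1 0 ξ +
        (c ξ * Real.sin (b ξ)) • wave r 1 (Real.pi / 2) ξ := funext fun ξ => wave_eq r _ _ ξ
    rw [h]
    exact ((hc.mul (Real.measurable_cos.comp hb)).aestronglyMeasurable.smul
      (continuous_wave_one r 0).aestronglyMeasurable).add
      ((hc.mul (Real.measurable_sin.comp hb)).aestronglyMeasurable.smul
      (continuous_wave_one r _).aestronglyMeasurable)
  exact (integrable_of_sq hc hc2).abs.mono' hm
    (Filter.Eventually.of_forall fun ξ => norm_wave_le r _ _ ξ)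

/-- The deviation of an empirical mean of waves from the expectation. -/
def waveError (μ : Measure (EuclideanSpace ℝ ι)) (r : ℝ) (c b : EuclideanSpace ℝ ι → ℝ) {n : ℕ}
    (ω : Fin n → EuclideanSpace ℝ ι) : C(Metric.closedBall (0 : EuclideanSpace ℝ ι) r, ℝ) :=
  (n : ℝ)⁻¹ • ∑ i, wave r (c (ω i)) (b (ω i)) (ω i) - ∫ ξ, wave r (c ξ) (b ξ) ξ ∂μ

theorem integrable_norm_waveError (r : ℝ) (hc : Measurable c) (hb : Measurable b)
    (hc2 : Integrable (fun ξ => c ξ ^ 2) μ) (n : ℕ) :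
    Integrable (fun ω : Fin n → EuclideanSpace ℝ ι => ‖waveError μ r c b ω‖)
      (Measure.pi fun _ : Fin n => μ) := by
  have key : ∀ {X : EuclideanSpace ℝ ι → C(Metric.closedBall (0 : EuclideanSpace ℝ ι) r, ℝ)},
      Integrable X μ → ∀ i : Fin n, Integrable (fun ω : Fin n → EuclideanSpace ℝ ι => X (ω i))
        (Measure.pi fun _ : Fin n => μ) := fun h i => integrable_comp_eval h
  exact (((integrable_finsetSum _ fun i _ => key (integrable_wave r hc hb hc2) i).smul
    (n : ℝ)⁻¹).sub (integrable_const _)).norm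

/-- As cosine is 1-Lipschitz, increments of the wave are dominated by the linear functional of `2π
c(ξ) ξ`. -/
theorem integral_norm_waveError_le {r : ℝ} (hr : 0 ≤ r) (hc : Measurable c)
    (hb : Measurable b) (hc2 : Integrable (fun ξ => c ξ ^ 2) μ)
    (hcξ : Integrable (fun ξ => c ξ ^ 2 * ‖ξ‖ ^ 2) μ) {n : ℕ} (hn : 0 < n) :
    ∫ ω, ‖waveError μ r c b ω‖ ∂(Measure.pi fun _ : Fin n => μ) ≤
      2 / √n * (√(∫ ξ, c ξ ^ 2 ∂μ) + 4 * Real.pi * r * √(∫ ξ, c ξ ^ 2 * ‖ξ‖ ^ 2 ∂μ)) := by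
  let v : EuclideanSpace ℝ ι → EuclideanSpace ℝ ι := fun ξ => (2 * Real.pi * c ξ) • ξ
  have hvn : ∀ ξ, ‖v ξ‖ ^ 2 = (2 * Real.pi) ^ 2 * (c ξ ^ 2 * ‖ξ‖ ^ 2) := by
    intro ξ
    simp only [v, norm_smul, Real.norm_eq_abs, mul_pow, sq_abs]
    ring
  have h0 : ∀ ξ, wave r (c ξ) (b ξ) ξ ⟨0, by simpa using hr⟩ ^ 2 ≤ c ξ ^ 2 := by
    intro ξ
    rw [wave_apply, mul_pow]
    exact mul_le_of_le_one_right (sq_nonneg _) (Real.cos_sq_le_one _)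
  have hX0 : Integrable (fun ξ => wave r (c ξ) (b ξ) ξ ⟨0, by simpa using hr⟩ ^ 2) μ := by
    refine hc2.mono' ?_ (Filter.Eventually.of_forall fun ξ => ?_)
    · have hm : Measurable fun ξ : EuclideanSpace ℝ ι => c ξ * Real.cos
          (b ξ + 2 * Real.pi * inner ℝ ξ (0 : EuclideanSpace ℝ ι)) := by
        simp only [inner_zero_right, mul_zero, add_zero]
        exact hc.mul (Real.measurable_cos.comp hb)
      exact (hm.pow_const 2).aestronglyMeasurable
    · rw [Real.norm_of_nonneg (sq_nonneg _)]
      exact h0 ξ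
  have hlip : ∀ ξ w w', |wave r (c ξ) (b ξ) ξ w - wave r (c ξ) (b ξ) ξ w'| ≤
      |inner ℝ (v ξ) ((w : EuclideanSpace ℝ ι) - w')| := by
    intro ξ w w'
    simp only [wave_apply, v, real_inner_smul_left, inner_sub_right]
    rw [← mul_sub, ← mul_sub, abs_mul, mul_comm (2 * Real.pi) (c ξ), mul_assoc (c ξ),
      abs_mul (c ξ), mul_sub]
    refine mul_le_mul_of_nonneg_left ?_ (abs_nonneg _)
    have := Real.abs_cos_sub_cos_le (b ξ + 2 * Real.pi * inner ℝ ξ (w : EuclideanSpace ℝ ι))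
      (b ξ + 2 * Real.pi * inner ℝ ξ (w' : EuclideanSpace ℝ ι))
    rwa [add_sub_add_left_eq_sub] at this
  have hv : Integrable (fun ξ => ‖v ξ‖ ^ 2) μ := by
    simp_rw [hvn]
    exact hcξ.const_mul _
  refine (integral_norm_mean_sub_le hr (integrable_wave r hc hb hc2) hlip hX0 hv hn).trans ?_
  have hsq : √(∫ ξ, ‖v ξ‖ ^ 2 ∂μ) = 2 * Real.pi * √(∫ ξ, c ξ ^ 2 * ‖ξ‖ ^ 2 ∂μ) := by
    simp_rw [hvn]
    rw [integral_const_mul, Real.sqrt_mul (by positivity), Real.sqrt_sq (by positivity)]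
  rw [hsq]
  refine mul_le_mul_of_nonneg_left ?_ (by positivity)
  refine add_le_add (Real.sqrt_le_sqrt (integral_mono hX0 hc2 h0)) (le_of_eq (by ring))

/-- Evaluation at a point is continuous and linear, so it commutes with the integral of
function-valued waves. -/
theorem abs_mean_sub_integral_le (r : ℝ) (hc : Measurable c) (hb : Measurable b)
    (hc2 : Integrable (fun ξ => c ξ ^ 2) μ) {n : ℕ} (ω : Fin n → EuclideanSpace ℝ ι)
    {w : EuclideanSpace ℝ ι} (hw : w ∈ Metric.closedBall (0 : EuclideanSpace ℝ ι) r) :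
    |(n : ℝ)⁻¹ * ∑ i, c (ω i) * Real.cos (b (ω i) + 2 * Real.pi * inner ℝ (ω i) w) -
      ∫ ξ, c ξ * Real.cos (b ξ + 2 * Real.pi * inner ℝ ξ w) ∂μ| ≤ ‖waveError μ r c b ω‖ := by
  have h1 : (∫ ξ, wave r (c ξ) (b ξ) ξ ∂μ) ⟨w, hw⟩ =
      ∫ ξ, c ξ * Real.cos (b ξ + 2 * Real.pi * inner ℝ ξ w) ∂μ :=
    ((ContinuousMap.evalCLM ℝ ⟨w, hw⟩).integral_comp_comm (integrable_wave r hc hb hc2)).symm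
  have h2 := ContinuousMap.norm_coe_le_norm (waveError μ r c b ω) ⟨w, hw⟩
  rw [waveError, ContinuousMap.sub_apply, h1, ContinuousMap.smul_apply, ContinuousMap.coe_sum,
    Finset.sum_apply] at h2
  exact h2

/-! ### Joint sampling error of a wave mean and its gradient. -/

theorem sum_sqrt_le_sqrt_card_mul {κ : Type*} [Fintype κ] {a : κ → ℝ} (ha : ∀ k, 0 ≤ a k) :
    ∑ k, √(a k) ≤ √(Fintype.card κ) * √(∑ k, a k) := by
  rw [← Real.sqrt_mul (Nat.cast_nonneg _)]
  refine Real.le_sqrt_of_sq_le ?_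
  have h := sq_sum_le_card_mul_sum_sq (s := (Finset.univ : Finset κ)) (f := fun k => √(a k))
  simpa [Real.sq_sqrt (ha _)] using h

/-- The derivative is written as a cosine with phase shifted by `π / 2`, so each partial derivative
is again a wave and the same error bound applies to it. -/
theorem hasFDerivAt_cos_wave (a β : ℝ) (ξ w : EuclideanSpace ℝ ι) :
    HasFDerivAt (fun w => a * Real.cos (β + 2 * Real.pi * inner ℝ ξ w))
      ((2 * Real.pi * a * Real.cos (β + Real.pi / 2 + 2 * Real.pi * inner ℝ ξ w)) •
        innerSL ℝ ξ) w := by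
  have h1 : HasFDerivAt (fun w => β + 2 * Real.pi * inner ℝ ξ w)
      ((2 * Real.pi) • innerSL ℝ ξ) w :=
    (((innerSL ℝ ξ).hasFDerivAt (x := w)).const_mul (2 * Real.pi)).const_add β
  have h2 := (h1.cos).const_mul a
  refine h2.congr_fderiv ?_
  rw [add_right_comm, Real.cos_add_pi_div_two, smul_smul, smul_smul]
  congr 1
  ring

/-- The gradient of a mean of waves. -/
theorem hasFDerivAt_integral_wave {A : ℝ} (hb : Measurable b)
    (h1 : Integrable (fun ξ => ‖ξ‖) μ) (w : EuclideanSpace ℝ ι) :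
    HasFDerivAt (fun w => ∫ ξ, A * Real.cos (b ξ + 2 * Real.pi * inner ℝ ξ w) ∂μ)
      (∫ ξ, (2 * Real.pi * A * Real.cos (b ξ + Real.pi / 2 + 2 * Real.pi * inner ℝ ξ w)) •
        innerSL ℝ ξ ∂μ) w := by
  have hm : ∀ (β : EuclideanSpace ℝ ι → ℝ) (_ : Measurable β) (w : EuclideanSpace ℝ ι),
      Measurable fun ξ => Real.cos (β ξ + 2 * Real.pi * inner ℝ ξ w) := by
    intro β hβ w
    exact Real.measurable_cos.comp (hβ.add (by fun_prop))
  refine hasFDerivAt_integral_of_dominated_of_fderiv_le (𝕜 := ℝ) (s := Set.univ)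
    (F := fun w ξ => A * Real.cos (b ξ + 2 * Real.pi * inner ℝ ξ w))
    (F' := fun w ξ => (2 * Real.pi * A * Real.cos (b ξ + Real.pi / 2 + 2 * Real.pi *
      inner ℝ ξ w)) • innerSL ℝ ξ)
    (bound := fun ξ => |2 * Real.pi * A| * ‖ξ‖) Filter.univ_mem
    (Filter.Eventually.of_forall fun w => ((hm b hb w).const_mul A).aestronglyMeasurable)
    ?_ ?_ ?_ (h1.const_mul _) ?_
  · refine (integrable_const |A|).mono' ((hm b hb w).const_mul A).aestronglyMeasurable
      (Filter.Eventually.of_forall fun ξ => ?_)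
    rw [Real.norm_eq_abs, abs_mul]
    exact mul_le_of_le_one_right (abs_nonneg A) (Real.abs_cos_le_one _)
  · exact ((hm _ (hb.add_const _) w).const_mul _).aestronglyMeasurable.smul
      (innerSL ℝ).continuous.aestronglyMeasurable
  · refine Filter.Eventually.of_forall fun ξ w _ => ?_
    rw [norm_smul, innerSL_apply_norm, Real.norm_eq_abs, abs_mul]
    exact mul_le_mul_of_nonneg_right
      (mul_le_of_le_one_right (abs_nonneg _) (Real.abs_cos_le_one _)) (norm_nonneg _)
  · exact Filter.Eventually.of_forall fun ξ w _ => hasFDerivAt_cos_wave A (b ξ) ξ w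

/-- The constant in the approximation by random waves. -/
def waveConst (m : ℕ) (r A m₂ m₄ : ℝ) : ℝ :=
  2 * (A + 4 * Real.pi * r * (A * √m₂)) +
    2 * (√m * (2 * Real.pi * A * √m₂) + 4 * Real.pi * r * (√m * (2 * Real.pi * A * √m₄)))

theorem integrable_norm_pow {p q : ℕ} (hpq : p ≤ q) (hq : Integrable (fun ξ => ‖ξ‖ ^ q) μ) :
    Integrable (fun ξ => ‖ξ‖ ^ p) μ := by
  refine (hq.add (integrable_const 1)).mono' (by fun_prop)
    (Filter.Eventually.of_forall fun ξ => ?_)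
  change ‖‖ξ‖ ^ p‖ ≤ ‖ξ‖ ^ q + 1
  rw [Real.norm_of_nonneg (by positivity)]
  rcases le_total ‖ξ‖ 1 with h | h
  · have := pow_le_one₀ (n := p) (norm_nonneg ξ) h
    have : 0 ≤ ‖ξ‖ ^ q := by positivity
    linarith
  · have := pow_le_pow_right₀ h hpq
    linarith

theorem sum_sq_coord (ξ : EuclideanSpace ℝ ι) : ∑ k, ξ k ^ 2 = ‖ξ‖ ^ 2 := by
  simp [EuclideanSpace.norm_sq_eq, sq_abs]

theorem sq_coord_le (k : ι) (ξ : EuclideanSpace ℝ ι) : ξ k ^ 2 ≤ ‖ξ‖ ^ 2 := by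
  rw [← sum_sq_coord]
  exact Finset.single_le_sum (f := fun k => ξ k ^ 2) (fun _ _ => sq_nonneg _) (Finset.mem_univ k)

/-- The coordinates of the gradients of waves. -/
def gradCoeff (A : ℝ) (k : ι) (ξ : EuclideanSpace ℝ ι) : ℝ := 2 * Real.pi * A * ξ k

theorem measurable_gradCoeff {κ : Type*} (A : ℝ) (k : κ) :
    Measurable (gradCoeff A k : EuclideanSpace ℝ κ → ℝ) := by
  unfold gradCoeff
  fun_prop

theorem integrable_gradCoeff_sq_mul {ν : Measure (EuclideanSpace ℝ ι)} (A : ℝ) (k : ι) {q : ℕ}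
    (h : Integrable (fun ξ => ‖ξ‖ ^ (2 + q)) ν) :
    Integrable (fun ξ => gradCoeff A k ξ ^ 2 * ‖ξ‖ ^ q) ν := by
  refine (h.const_mul ((2 * Real.pi * A) ^ 2)).mono' (Measurable.aestronglyMeasurable
    (((measurable_gradCoeff A k).pow_const 2).mul (by fun_prop)))
    (Filter.Eventually.of_forall fun ξ => ?_)
  rw [Real.norm_of_nonneg (by positivity), gradCoeff, mul_pow, pow_add, mul_assoc]
  have := sq_coord_le k ξ
  gcongr

/-- The squared coordinates add up to `‖ξ‖ ^ 2`, so by Cauchy–Schwarz summing over all partial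
derivatives costs only the square root of the dimension. -/
theorem sum_sqrt_gradCoeff_le {ν : Measure (EuclideanSpace ℝ ι)} {A : ℝ} (hA : 0 ≤ A) {q : ℕ}
    (h : Integrable (fun ξ => ‖ξ‖ ^ (2 + q)) ν) :
    ∑ k, √(∫ ξ, gradCoeff A k ξ ^ 2 * ‖ξ‖ ^ q ∂ν) ≤
      √(Fintype.card ι) * (2 * Real.pi * A * √(∫ ξ, ‖ξ‖ ^ (2 + q) ∂ν)) := by
  refine (sum_sqrt_le_sqrt_card_mul fun k => integral_nonneg fun ξ => by positivity).trans
    (le_of_eq ?_)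
  rw [← integral_finsetSum _ fun k _ => integrable_gradCoeff_sq_mul A k h]
  have : ∀ ξ : EuclideanSpace ℝ ι, ∑ k, gradCoeff A k ξ ^ 2 * ‖ξ‖ ^ q =
      (2 * Real.pi * A) ^ 2 * ‖ξ‖ ^ (2 + q) := by
    intro ξ
    simp only [gradCoeff, mul_pow _ (ξ _) 2]
    rw [← Finset.sum_mul, ← Finset.mul_sum, sum_sq_coord, mul_assoc, pow_add]
  simp_rw [this]
  rw [integral_const_mul, Real.sqrt_mul (sq_nonneg _), Real.sqrt_sq (by positivity)]

/-- First-moment method: some sample does no worse than the mean. Applying it to the sum of all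
errors makes one sample good for the function and every partial derivative. -/
theorem exists_waveError_le {A : ℝ} (hA : 0 ≤ A) (hb : Measurable b)
    (h4 : Integrable (fun ξ => ‖ξ‖ ^ 4) μ) {r : ℝ} (hr : 0 ≤ r) {n : ℕ} (hn : 0 < n) :
    ∃ ω : Fin n → EuclideanSpace ℝ ι, ‖waveError μ r (fun _ => A) b ω‖ +
      ∑ k, ‖waveError μ r (gradCoeff A k) (fun ξ => b ξ + Real.pi / 2) ω‖ ≤
      waveConst (Fintype.card ι) r A (∫ ξ, ‖ξ‖ ^ 2 ∂μ) (∫ ξ, ‖ξ‖ ^ 4 ∂μ) / √n := by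
  have h2 : Integrable (fun ξ : EuclideanSpace ℝ ι => ‖ξ‖ ^ 2) μ :=
    integrable_norm_pow (by norm_num) h4
  have hb' : Measurable fun ξ => b ξ + Real.pi / 2 := hb.add_const _
  have hA2 : Integrable (fun _ : EuclideanSpace ℝ ι => A ^ 2) μ := integrable_const _
  have hA4 : Integrable (fun ξ : EuclideanSpace ℝ ι => A ^ 2 * ‖ξ‖ ^ 2) μ := h2.const_mul _
  have hc2 : ∀ k, Integrable (fun ξ : EuclideanSpace ℝ ι => gradCoeff A k ξ ^ 2) μ := fun k => by
    simpa using integrable_gradCoeff_sq_mul (q := 0) A k h2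
  have hc4 := fun k => integrable_gradCoeff_sq_mul (q := 2) A k h4
  have hZ₀i := integrable_norm_waveError (μ := μ) r measurable_const hb hA2 n
  have hZi := fun k => integrable_norm_waveError (μ := μ) r (measurable_gradCoeff A k) hb' (hc2 k) n
  have hZ₀ := integral_norm_waveError_le hr measurable_const hb hA2 hA4 hn
  have hq2 := sum_sqrt_gradCoeff_le (q := 0) hA h2
  have hq4 := sum_sqrt_gradCoeff_le (q := 2) hA h4
  simp only [pow_zero, mul_one, add_zero] at hq2
  have hZ := Finset.sum_le_sum fun k (_ : k ∈ Finset.univ) =>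
    integral_norm_waveError_le hr (measurable_gradCoeff A k) hb' (hc2 k) (hc4 k) hn
  obtain ⟨ω, hω⟩ := exists_le_integral (hZ₀i.add (integrable_finsetSum Finset.univ
    fun k _ => hZi k))
  refine ⟨ω, hω.trans ?_⟩
  rw [integral_add' hZ₀i (integrable_finsetSum Finset.univ fun k _ => hZi k),
    integral_finsetSum _ fun k _ => hZi k]
  rw [integral_const_mul, Real.sqrt_mul (sq_nonneg A), Real.sqrt_sq hA] at hZ₀
  simp only [integral_const, probReal_univ, one_smul, Real.sqrt_sq hA] at hZ₀
  rw [← Finset.mul_sum, Finset.sum_add_distrib, ← Finset.mul_sum] at hZ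
  refine (add_le_add hZ₀ (hZ.trans (mul_le_mul_of_nonneg_left (add_le_add hq2
    (mul_le_mul_of_nonneg_left hq4 (by positivity))) (by positivity)))).trans (le_of_eq ?_)
  rw [waveConst]
  ring

theorem norm_le_sum_abs_apply_single (L : EuclideanSpace ℝ ι →L[ℝ] ℝ) [DecidableEq ι] :
    ‖L‖ ≤ ∑ k, |L (EuclideanSpace.single k 1)| := by
  refine ContinuousLinearMap.opNorm_le_bound _ (Finset.sum_nonneg fun _ _ => abs_nonneg _)
    fun v => ?_
  have hv : v = ∑ k, v k • EuclideanSpace.single k (1 : ℝ) := by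
    have := (EuclideanSpace.basisFun ι ℝ).sum_repr v
    simpa using this.symm
  conv_lhs => rw [hv]
  rw [map_sum, Finset.sum_mul]
  refine (norm_sum_le _ _).trans (Finset.sum_le_sum fun k _ => ?_)
  rw [map_smul, norm_smul, mul_comm]
  exact mul_le_mul_of_nonneg_left (PiLp.norm_apply_le v k) (abs_nonneg _)

/-- Simultaneous uniform approximation of a mean of waves and of its gradient by an empirical
mean. -/
theorem exists_mean_wave_approx {A : ℝ} (hA : 0 ≤ A) (hb : Measurable b)
    (h4 : Integrable (fun ξ => ‖ξ‖ ^ 4) μ) {r : ℝ} (hr : 0 ≤ r) {n : ℕ} (hn : 0 < n) :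
    ∃ ω : Fin n → EuclideanSpace ℝ ι, ∃ D : EuclideanSpace ℝ ι → ℝ,
      (∀ w, D w = (n : ℝ)⁻¹ * ∑ i, A * Real.cos (b (ω i) + 2 * Real.pi * inner ℝ (ω i) w) -
        ∫ ξ, A * Real.cos (b ξ + 2 * Real.pi * inner ℝ ξ w) ∂μ) ∧
      Differentiable ℝ D ∧
      ∀ w ∈ Metric.closedBall (0 : EuclideanSpace ℝ ι) r,
        |D w| ≤ waveConst (Fintype.card ι) r A (∫ ξ, ‖ξ‖ ^ 2 ∂μ) (∫ ξ, ‖ξ‖ ^ 4 ∂μ) / √n ∧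
        ‖fderiv ℝ D w‖ ≤
          waveConst (Fintype.card ι) r A (∫ ξ, ‖ξ‖ ^ 2 ∂μ) (∫ ξ, ‖ξ‖ ^ 4 ∂μ) / √n := by
  classical
  obtain ⟨ω, hω⟩ := exists_waveError_le hA hb h4 hr hn
  have h2 : Integrable (fun ξ : EuclideanSpace ℝ ι => ‖ξ‖ ^ 2) μ :=
    integrable_norm_pow (by norm_num) h4
  have h1 : Integrable (fun ξ : EuclideanSpace ℝ ι => ‖ξ‖) μ := by
    simpa using integrable_norm_pow (p := 1) (by norm_num) h4
  have hb' : Measurable fun ξ => b ξ + Real.pi / 2 := hb.add_const _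
  have hc2 : ∀ k, Integrable (fun ξ : EuclideanSpace ℝ ι => gradCoeff A k ξ ^ 2) μ := fun k => by
    simpa using integrable_gradCoeff_sq_mul (q := 0) A k h2
  have hZs : 0 ≤ ∑ k, ‖waveError μ r (gradCoeff A k) (fun ξ => b ξ + Real.pi / 2) ω‖ :=
    Finset.sum_nonneg fun k _ => norm_nonneg _
  have hZ₀ := norm_nonneg (waveError μ r (fun _ => A) b ω)
  have hD : ∀ w, HasFDerivAt (fun w => (n : ℝ)⁻¹ * ∑ i, A * Real.cos (b (ω i) +
      2 * Real.pi * inner ℝ (ω i) w) -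
        ∫ ξ, A * Real.cos (b ξ + 2 * Real.pi * inner ℝ ξ w) ∂μ)
      ((n : ℝ)⁻¹ • ∑ i, (2 * Real.pi * A * Real.cos (b (ω i) + Real.pi / 2 +
        2 * Real.pi * inner ℝ (ω i) w)) • innerSL ℝ (ω i) -
      ∫ ξ, (2 * Real.pi * A * Real.cos (b ξ + Real.pi / 2 + 2 * Real.pi * inner ℝ ξ w)) •
        innerSL ℝ ξ ∂μ) w := fun w =>
    ((HasFDerivAt.fun_sum fun i _ => hasFDerivAt_cos_wave A (b (ω i)) (ω i) w).const_mul _).sub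
      (hasFDerivAt_integral_wave hb h1 w)
  refine ⟨ω, _, fun w => rfl, fun w => (hD w).differentiableAt, fun w hw => ⟨?_, ?_⟩⟩
  · refine (abs_mean_sub_integral_le (μ := μ) r measurable_const hb (integrable_const _) ω
      hw).trans ?_
    linarith
  · have hi : Integrable (fun ξ : EuclideanSpace ℝ ι => (2 * Real.pi * A * Real.cos (b ξ + Real.pi / 2 +
        2 * Real.pi * inner ℝ ξ w)) • innerSL ℝ ξ) μ := by
      refine (h1.const_mul |2 * Real.pi * A|).mono' ?_ (Filter.Eventually.of_forall fun ξ => ?_)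
      · have hm : Measurable fun ξ : EuclideanSpace ℝ ι =>
            Real.cos (b ξ + Real.pi / 2 + 2 * Real.pi * inner ℝ ξ w) :=
          Real.measurable_cos.comp (hb'.add (by fun_prop))
        exact (hm.const_mul _).aestronglyMeasurable.smul
          (innerSL ℝ).continuous.aestronglyMeasurable
      · rw [norm_smul, innerSL_apply_norm, Real.norm_eq_abs, abs_mul]
        exact mul_le_mul_of_nonneg_right
          (mul_le_of_le_one_right (abs_nonneg _) (Real.abs_cos_le_one _)) (norm_nonneg _)
    have hfd := (hD w).fderiv
    refine (norm_le_sum_abs_apply_single _).trans ((Finset.sum_le_sum fun k _ => ?_).trans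
      (by linarith : ∑ k, ‖waveError μ r (gradCoeff A k) (fun ξ => b ξ + Real.pi / 2) ω‖ ≤ _))
    -- The `k`-th partial derivative of the error is the error of the waves with coefficient
    -- `gradCoeff A k` and shifted phase.
    refine le_trans (le_of_eq ?_) (abs_mean_sub_integral_le (μ := μ) r (measurable_gradCoeff A k)
      hb' (hc2 k) ω hw)
    congr 1
    refine (DFunLike.congr_fun hfd _).trans ?_
    rw [_root_.sub_apply, ContinuousLinearMap.integral_apply hi]
    simp [gradCoeff, EuclideanSpace.inner_single_right, mul_right_comm]

end

/-! ### Approximation of a function by one circuit -/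

section

variable {N d : ℕ} {f : JointSpace N d → ℝ}

theorem continuous_fourierTransform (hf : Integrable f) : Continuous (fourierTransform f) :=
  VectorFourier.fourierIntegral_continuous Real.continuous_fourierChar
    (L := innerₗ (JointSpace N d)) continuous_inner hf.ofReal

/-- The real part of Fourier inversion, with `f̂(ξ)` in polar form. -/
theorem eq_integral_cos (hf : f ∈ BarronClass N d) (w : JointSpace N d) :
    f w = ∫ ξ, ‖fourierTransform f ξ‖ *
      Real.cos ((fourierTransform f ξ).arg + 2 * Real.pi * inner ℝ ξ w) := by
  obtain ⟨hc, hi, hF⟩ := hf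
  have h := congrFun (Continuous.fourierInv_fourier_eq (f := fun y => (f y : ℂ))
    (Complex.continuous_ofReal.comp hc) hi.ofReal hF) w
  rw [Real.fourierInv_eq'] at h
  have hint : Integrable fun ξ => Complex.exp (↑(2 * Real.pi * inner ℝ ξ w) * Complex.I) •
      fourierTransform f ξ := by
    refine (integrable_norm_iff ?_).1 ?_
    · have he : Continuous fun ξ : JointSpace N d =>
          Complex.exp (↑(2 * Real.pi * inner ℝ ξ w) * Complex.I) := by fun_prop
      exact (he.smul (continuous_fourierTransform hi)).aestronglyMeasurable
    · simpa only [norm_smul, Complex.norm_exp_ofReal_mul_I, one_mul] using hF.norm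
  have h2 := congrArg Complex.re h
  rw [Complex.ofReal_re] at h2
  rw [← h2]
  refine (integral_re hint).symm.trans (integral_congr_ae (Filter.Eventually.of_forall fun ξ => ?_))
  change (Complex.exp (↑(2 * Real.pi * inner ℝ ξ w) * Complex.I) • fourierTransform f ξ).re = _
  conv_lhs => rw [← Complex.norm_mul_exp_arg_mul_I (fourierTransform f ξ)]
  rw [smul_eq_mul, mul_left_comm, ← Complex.exp_add, ← add_mul, ← Complex.ofReal_add,
    Complex.re_ofReal_mul, Complex.exp_ofReal_mul_I_re, add_comm]

theorem abs_le_fourierNorm (hf : f ∈ BarronClass N d) (w : JointSpace N d) :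
    |f w| ≤ fourierNorm f := by
  rw [eq_integral_cos hf w, fourierNorm, ← Real.norm_eq_abs]
  refine norm_integral_le_of_norm_le hf.2.2.norm (Filter.Eventually.of_forall fun ξ => ?_)
  rw [norm_mul, norm_norm]
  exact mul_le_of_le_one_right (norm_nonneg _) (Real.abs_cos_le_one _)

theorem fourierNorm_nonneg : 0 ≤ fourierNorm f := integral_nonneg fun _ => norm_nonneg _

/-- The probability measure with density `|f̂| / ‖f̂‖₁`. -/
def spectralMeasure (f : JointSpace N d → ℝ) : Measure (JointSpace N d) :=
  volume.withDensity fun ξ => ENNReal.ofReal (‖fourierTransform f ξ‖ / fourierNorm f)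

theorem measurable_spectralDensity (hf : Integrable f) :
    Measurable fun ξ => ENNReal.ofReal (‖fourierTransform f ξ‖ / fourierNorm f) :=
  ((continuous_fourierTransform hf).norm.measurable.div_const _).ennreal_ofReal

theorem integral_spectralMeasure (hf : Integrable f) (g : JointSpace N d → ℝ) :
    ∫ ξ, g ξ ∂(spectralMeasure f) =
      (fourierNorm f)⁻¹ * ∫ ξ, ‖fourierTransform f ξ‖ * g ξ := by
  rw [spectralMeasure, integral_withDensity_eq_integral_toReal_smul (measurable_spectralDensity hf)
    (Filter.Eventually.of_forall fun _ => ENNReal.ofReal_lt_top), ← integral_const_mul]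
  refine integral_congr_ae (Filter.Eventually.of_forall fun ξ => ?_)
  simp only [smul_eq_mul]
  rw [ENNReal.toReal_ofReal (div_nonneg (norm_nonneg _) fourierNorm_nonneg)]
  ring

theorem integrable_spectralMeasure (hf : Integrable f) {g : JointSpace N d → ℝ}
    (hg : Integrable fun ξ => g ξ * ‖fourierTransform f ξ‖) :
    Integrable g (spectralMeasure f) := by
  rw [spectralMeasure, integrable_withDensity_iff_integrable_smul' (measurable_spectralDensity hf)
    (Filter.Eventually.of_forall fun _ => ENNReal.ofReal_lt_top)]
  refine (hg.const_mul (fourierNorm f)⁻¹).congr (Filter.Eventually.of_forall fun ξ => ?_)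
  simp only [smul_eq_mul]
  rw [ENNReal.toReal_ofReal (div_nonneg (norm_nonneg _) fourierNorm_nonneg)]
  ring

theorem isProbabilityMeasure_spectralMeasure (hf : f ∈ BarronClass N d) (hA : 0 < fourierNorm f) :
    IsProbabilityMeasure (spectralMeasure f) := by
  constructor
  rw [spectralMeasure, withDensity_apply _ MeasurableSet.univ, Measure.restrict_univ,
    ← ofReal_integral_eq_lintegral_ofReal (hf.2.2.norm.div_const _)
      (Filter.Eventually.of_forall fun ξ => div_nonneg (norm_nonneg _) fourierNorm_nonneg),
    integral_div]
  change ENNReal.ofReal (fourierNorm f / fourierNorm f) = 1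
  rw [div_self hA.ne', ENNReal.ofReal_one]

/-- Normalizing the spectral measure turns `A * √(A⁻¹ * I)` into `√A * √I`. The fourth-moment terms
then agree; the slack is `2π A` and the replacement of `4π` by `4π²`. -/
theorem waveConst_le_constInfty {M : ℝ} (hA : 0 < fourierNorm f) :
    waveConst (Fintype.card (Fin N ⊕ Fin d)) (M * √((N : ℝ) + d)) (fourierNorm f)
      ((fourierNorm f)⁻¹ * fourierMoment 2 f) ((fourierNorm f)⁻¹ * fourierMoment 4 f) ≤
      constInfty M f := by
  set A := fourierNorm f with hAdef
  have hs : ∀ I : ℝ, A * √(A⁻¹ * I) = √A * √I := by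
    intro I
    rw [Real.sqrt_mul (inv_nonneg.2 hA.le), Real.sqrt_inv, ← mul_assoc]
    congr 1
    rw [← div_eq_mul_inv, Real.div_sqrt]
  have hcard : ((Fintype.card (Fin N ⊕ Fin d) : ℕ) : ℝ) = (N : ℝ) + d := by simp
  have hK : √((N : ℝ) + d) * √((N : ℝ) + d) = (N : ℝ) + d := Real.mul_self_sqrt (by positivity)
  have hpi : 1 ≤ Real.pi := by linarith [Real.pi_gt_three]
  have hU : 0 ≤ √((N : ℝ) + d) * (√A * √(fourierMoment 2 f)) := by positivity
  have hAp : 0 ≤ Real.pi * A := by positivity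
  have h4 : 4 * Real.pi * (√((N : ℝ) + d) * (√A * √(fourierMoment 2 f))) ≤
      4 * Real.pi ^ 2 * (√((N : ℝ) + d) * (√A * √(fourierMoment 2 f))) :=
    mul_le_mul_of_nonneg_right (by nlinarith) hU
  rw [waveConst, hcard, constInfty, hs, mul_assoc (2 * Real.pi) A, hs, mul_assoc (2 * Real.pi) A,
    hs, ← hAdef]
  have h5 : 2 * (4 * Real.pi * (M * √((N : ℝ) + d)) *
      (√((N : ℝ) + d) * (2 * Real.pi * (√A * √(fourierMoment 4 f))))) =
      16 * M * Real.pi ^ 2 * ((N : ℝ) + d) * √A * √(fourierMoment 4 f) := by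
    linear_combination (16 * M * Real.pi ^ 2 * √A * √(fourierMoment 4 f)) * hK
  rw [mul_add 2 (√((N : ℝ) + d) * _), h5]
  nlinarith

theorem constInfty_nonneg {M : ℝ} (hM : 0 ≤ M) : 0 ≤ constInfty M f := by
  have := fourierNorm_nonneg (f := f)
  unfold constInfty
  positivity

/-- One circuit approximates a function of Barron type and its gradient on a box. -/
theorem exists_circuit_approx {R M : ℝ} (hR : 0 < R) (hM : 0 ≤ M) (hf : f ∈ BarronBall N d R)
    (h4 : Integrable fun ξ => ‖ξ‖ ^ 4 * ‖fourierTransform f ξ‖) {n : ℕ} (hn : 0 < n) :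
    ∃ θ : CircuitParams N d n, ∃ D : JointSpace N d → ℝ,
      (∀ w, D w = R / n * ∑ i, Real.cos (θ i).2.2 *
        Real.cos ((θ i).2.1 + inner ℝ (θ i).1 w) - f w) ∧
      Differentiable ℝ D ∧
      ∀ w ∈ Metric.closedBall (0 : JointSpace N d) (M * √((N : ℝ) + d)),
        |D w| ≤ constInfty M f / √n ∧ ‖fderiv ℝ D w‖ ≤ constInfty M f / √n := by
  have hpi := Real.pi_pos
  rcases fourierNorm_nonneg.eq_or_lt with hA | hA
  -- If `‖f̂‖₁ = 0` there is no probability measure to sample from, but `f` vanishes and the angle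
  -- `π / 2` switches the circuit off.
  · have hf0 : ∀ w, f w = 0 := fun w =>
      abs_nonpos_iff.1 ((abs_le_fourierNorm hf.1 w).trans hA.symm.le)
    refine ⟨fun _ => (0, 0, ⟨Real.pi / 2, by constructor <;> linarith⟩), fun _ => 0, fun w => ?_,
      differentiable_const _, fun w _ => ?_⟩
    · simp [hf0]
    · have := div_nonneg (constInfty_nonneg (f := f) hM) (Real.sqrt_nonneg n)
      simpa using this
  · have hi := hf.1.2.1
    have := isProbabilityMeasure_spectralMeasure hf.1 hA
    have hb : Measurable fun ξ => (fourierTransform f ξ).arg :=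
      Complex.measurable_arg.comp (continuous_fourierTransform hi).measurable
    obtain ⟨ω, D, hD, hdiff, hbound⟩ := exists_mean_wave_approx hA.le hb
      (integrable_spectralMeasure hi h4) (by positivity : 0 ≤ M * √((N : ℝ) + d)) hn
    have hmom : ∀ q : ℕ, ∫ ξ, ‖ξ‖ ^ q ∂(spectralMeasure f) =
        (fourierNorm f)⁻¹ * fourierMoment q f := by
      intro q
      rw [integral_spectralMeasure hi, fourierMoment]
      simp_rw [mul_comm]
    rw [hmom, hmom] at hbound
    have hle := div_le_div_of_nonneg_right (waveConst_le_constInfty (f := f) (M := M) hA)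
      (Real.sqrt_nonneg n)
    have hrep : ∀ w, f w = ∫ ξ, fourierNorm f * Real.cos ((fourierTransform f ξ).arg +
        2 * Real.pi * inner ℝ ξ w) ∂(spectralMeasure f) := by
      intro w
      rw [integral_spectralMeasure hi, eq_integral_cos hf.1 w]
      simp_rw [mul_left_comm _ (fourierNorm f)]
      rw [integral_const_mul, inv_mul_cancel_left₀ hA.ne']
    -- This angle rescales the fixed amplitude `R` to `‖f̂‖₁`; here `‖f̂‖₁ ≤ R` is needed.
    have hγ : Real.cos (Real.arccos (fourierNorm f / R)) = fourierNorm f / R :=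
      Real.cos_arccos (by linarith [div_nonneg hA.le hR.le]) ((div_le_one hR).2 hf.2)
    refine ⟨fun i => ((2 * Real.pi) • ω i, (fourierTransform f (ω i)).arg,
      ⟨Real.arccos (fourierNorm f / R), Real.arccos_nonneg _,
        (Real.arccos_le_pi _).trans (by linarith)⟩), D, fun w => ?_, hdiff,
      fun w hw => ⟨(hbound w hw).1.trans hle, (hbound w hw).2.trans hle⟩⟩
    rw [hD, hrep]
    simp only [hγ, real_inner_smul_left]
    rw [← Finset.mul_sum, ← Finset.mul_sum]
    congr 1
    field_simp

end

/-! ### Universality of the network -/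

theorem euclidean_norm_le {ι : Type*} [Fintype ι] {v : EuclideanSpace ℝ ι} {b : ℝ} (hb : 0 ≤ b)
    (h : ∀ j, |v j| ≤ b) : ‖v‖ ≤ √(Fintype.card ι) * b := by
  rw [EuclideanSpace.norm_eq]
  refine Real.sqrt_le_iff.2 ⟨by positivity, ?_⟩
  rw [mul_pow, Real.sq_sqrt (Nat.cast_nonneg _), ← nsmul_eq_mul, ← Finset.card_univ]
  exact Finset.sum_le_card_nsmul _ _ _ fun j _ => pow_le_pow_left₀ (norm_nonneg _) (h j) 2

theorem norm_joint_sub {N d : ℕ} (x y : EuclideanSpace ℝ (Fin N)) (z : EuclideanSpace ℝ (Fin d)) :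
    ‖joint x z - joint y z‖ = ‖x - y‖ := by
  simp [EuclideanSpace.norm_eq, joint]

theorem joint_mem_closedBall {N d : ℕ} {M : ℝ} (hM : 0 ≤ M) {x : EuclideanSpace ℝ (Fin N)}
    {z : EuclideanSpace ℝ (Fin d)} (hx : ∀ j, |x j| ≤ M) (hz : ∀ k, |z k| ≤ M) :
    joint x z ∈ Metric.closedBall (0 : JointSpace N d) (M * √((N : ℝ) + d)) := by
  rw [mem_closedBall_zero_iff, mul_comm]
  have := euclidean_norm_le (v := joint x z) hM (by rintro (j | k); exacts [hx j, hz k])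
  simpa using this

theorem differentiable_joint {N d : ℕ} (z : EuclideanSpace ℝ (Fin d)) :
    Differentiable ℝ fun x : EuclideanSpace ℝ (Fin N) => joint x z := by
  rw [differentiable_euclidean]
  rintro (j | k)
  · exact (EuclideanSpace.proj (𝕜 := ℝ) j).differentiable
  · exact differentiable_const _

theorem lipschitz_of_fderiv_joint {N d : ℕ} {F : JointSpace N d → EuclideanSpace ℝ (Fin N)}
    (hF : Differentiable ℝ F) {z : EuclideanSpace ℝ (Fin d)} {lam : ℝ}
    (h : ∀ x : EuclideanSpace ℝ (Fin N),
      ‖fderiv ℝ (fun x' : EuclideanSpace ℝ (Fin N) => F (joint x' z)) x‖ ≤ lam)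
    (x y : EuclideanSpace ℝ (Fin N)) : ‖F (joint x z) - F (joint y z)‖ ≤ lam * ‖x - y‖ :=
  convex_univ.norm_image_sub_le_of_norm_fderiv_le
    (fun x _ => (hF.comp (differentiable_joint z)) x) (fun x _ => h x) (Set.mem_univ y)
    (Set.mem_univ x)

/-- The cube `[-R, R]^N`. -/
def cube (N : ℕ) (R : ℝ) : Set (EuclideanSpace ℝ (Fin N)) := {x | ∀ j, |x j| ≤ R}

theorem isClosed_cube (N : ℕ) (R : ℝ) : IsClosed (cube N R) := by
  simp only [cube, Set.ofPred_forall]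
  exact isClosed_iInter fun j => isClosed_le (by fun_prop) continuous_const

theorem norm_le_of_mem_cube {N : ℕ} {R : ℝ} (hR : 0 ≤ R) {x : EuclideanSpace ℝ (Fin N)}
    (hx : x ∈ cube N R) : ‖x‖ ≤ √(N : ℝ) * R := by
  simpa using euclidean_norm_le hR hx

/-- An average of products of cosines is at most 1 in modulus. No restriction on the state is
needed, so the network can be run on all of `ℝ^N`. -/
theorem rqnnMap_mem_cube {N d n : ℕ} (hn : 0 < n) {R : ℝ} (hR : 0 ≤ R)
    {V : Matrix (Fin (2 ^ numQubits n)) (Fin (2 ^ numQubits n)) ℂ}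
    (hV : IsPreparationGate n V) (θ : Fin N → CircuitParams N d n) (w : JointSpace N d) :
    rqnnMap R V θ w ∈ cube N R := by
  intro j
  have hn' : (0 : ℝ) < n := by exact_mod_cast hn
  rw [rqnnMap_apply hn R hV, abs_mul, abs_of_nonneg (div_nonneg hR hn'.le)]
  have h : |∑ i, Real.cos (θ j i).2.2 * Real.cos ((θ j i).2.1 + inner ℝ (θ j i).1 w)| ≤ n := by
    refine (Finset.abs_sum_le_sum_abs _ _).trans ?_
    refine (Finset.sum_le_card_nsmul _ _ 1 fun i _ => ?_).trans (by simp)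
    rw [abs_mul]
    exact mul_le_one₀ (Real.abs_cos_le_one _) (abs_nonneg _) (Real.abs_cos_le_one _)
  calc R / n * |_| ≤ R / n * n := mul_le_mul_of_nonneg_left h (div_nonneg hR hn'.le)
    _ = R := div_mul_cancel₀ R hn'.ne'

theorem numQubits_eq_ceil_logb (n : ℕ) : (numQubits n : ℤ) = ⌈Real.logb 2 (4 * n)⌉ := by
  have h := Real.ceil_logb_natCast (b := 2) (r := 4 * (n : ℝ)) (by positivity)
  have h2 := Int.clog_natCast (R := ℝ) 2 (4 * n)
  push_cast at h h2
  rw [h, h2, numQubits]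

theorem constInfty_le_max {N d : ℕ} (M : ℝ) (F : JointSpace N d → EuclideanSpace ℝ (Fin N))
    (j : Fin N) : constInfty M (fun w => F w j) ≤ maxConstInfty M F :=
  le_ciSup (f := fun j => constInfty M (fun w => F w j)) (Set.finite_range _).bddAbove j

end RQNN

end

/-! ### Echo state property of the network and comparison of the filters. -/

theorem mainTheorem1 (N d : ℕ) (R M lam : ℝ) (hR : 0 < R) (hlam0 : 0 < lam) (hlam1 : lam < 1)
    (F : RQNN.JointSpace N d → EuclideanSpace ℝ (Fin N))
    (B : Set (EuclideanSpace ℝ (Fin N))) (D : Set (EuclideanSpace ℝ (Fin d)))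
    (hD : IsCompact D)
    -- the state set of the target system: closed, non-empty and invariant
    (hBclosed : IsClosed B) (hBne : B.Nonempty)
    (hBinv : ∀ x ∈ B, ∀ z ∈ D, F (RQNN.joint x z) ∈ B)
    -- the box on which the constants are computed
    (hRM : R ≤ M) (hDM : ∀ z ∈ D, ∀ k, |z k| ≤ M)
    (hF : ContDiff ℝ 1 F)
    (hcontr : ∀ x : EuclideanSpace ℝ (Fin N), ∀ z ∈ D,
      ‖fderiv ℝ (fun x' : EuclideanSpace ℝ (Fin N) => F (RQNN.joint x' z)) x‖ ≤ lam)
    (hBarron : ∀ j, (fun w => F w j) ∈ RQNN.BarronBall N d R)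
    (hpartial : ∀ i j, RQNN.partialDeriv i (fun w => F w j) ∈ RQNN.BarronClass N d)
    (hmoment : ∀ j, MeasureTheory.Integrable fun ξ : RQNN.JointSpace N d =>
      ‖ξ‖ ^ 4 * ‖RQNN.fourierTransform (fun w => F w j) ξ‖) :
    ∃ hESP : RQNN.EchoStateProperty F B D,
      ∀ n : ℕ, (N : ℝ) ^ 2 * RQNN.maxConstInfty M F ^ 2 / (1 - lam) ^ 2 < n →
        (RQNN.numQubits n : ℤ) = ⌈Real.logb 2 (4 * n)⌉ ∧
        ∃ θ : Fin N → RQNN.CircuitParams N d n,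
          ∀ V, RQNN.IsPreparationGate n V →
            ∃ hESP' : RQNN.EchoStateProperty (RQNN.rqnnMap R V θ) Set.univ D,
              ∀ (z : RQNN.NegTime → D) (t : RQNN.NegTime),
                ‖(RQNN.stateFilter hESP z t : EuclideanSpace ℝ (Fin N))
                    - RQNN.stateFilter hESP' z t‖
                  ≤ 1 / (1 - lam) * (√(N : ℝ) * RQNN.maxConstInfty M F / √(n : ℝ)) := by
  have hFlip : ∀ z ∈ D, ∀ x y, ‖F (RQNN.joint x z) - F (RQNN.joint y z)‖ ≤ lam * ‖x - y‖ :=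
    fun z hz => RQNN.lipschitz_of_fderiv_joint (hF.differentiable one_ne_zero)
      fun x => hcontr x z hz
  have hFcube : ∀ w, F w ∈ RQNN.cube N R := fun w j =>
    (RQNN.abs_le_fourierNorm (hBarron j).1 w).trans (hBarron j).2
  have hM : 0 ≤ M := hR.le.trans hRM
  -- `B` may be unbounded; since `|F_j| ≤ ‖F̂_j‖₁ ≤ R`, trajectories stay in its intersection with
  -- the cube.
  have hESP : RQNN.EchoStateProperty F B D :=
    RQNN.echoStateProperty_of_contracting hBne (S := B ∩ RQNN.cube N R) Set.inter_subset_left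
      (hBclosed.inter (RQNN.isClosed_cube N R))
      (fun x hx => RQNN.norm_le_of_mem_cube hR.le hx.2)
      (fun x hx z hz => ⟨hBinv x hx z hz, hFcube _⟩) hlam0.le hlam1
      (fun x _ y _ z hz => hFlip z hz x y)
  refine ⟨hESP, fun n hn => ⟨RQNN.numQubits_eq_ceil_logb n, ?_⟩⟩
  set C := RQNN.maxConstInfty M F with hC
  have hC0 : 0 ≤ C := Real.iSup_nonneg fun j => RQNN.constInfty_nonneg hM
  have hlam : 0 < 1 - lam := by linarith
  have hn' : (0 : ℝ) < n := lt_of_le_of_lt (by positivity) hn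
  have hn0 : 0 < n := by exact_mod_cast hn'
  choose θ E hE hEdiff hEbound using fun j =>
    RQNN.exists_circuit_approx hR hM (hBarron j) (hmoment j) hn0
  have hCn : 0 ≤ C / √n := by positivity
  have hCj : ∀ j, RQNN.constInfty M (fun w => F w j) / √n ≤ C / √n := fun j =>
    div_le_div_of_nonneg_right (RQNN.constInfty_le_max M F j) (Real.sqrt_nonneg n)
  refine ⟨θ, fun V hV => ?_⟩
  have hdiff : ∀ w j, (RQNN.rqnnMap R V θ w - F w) j = E j w := by
    intro w j
    rw [hE, PiLp.sub_apply, RQNN.rqnnMap_apply hn0 R hV]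
  -- Here `R ≤ M` enters: states of the cube and inputs fit in one box of half-width `M`, which lies
  -- in the ball of the approximation.
  have hball : ∀ x ∈ RQNN.cube N R, ∀ z ∈ D, RQNN.joint x z ∈
      Metric.closedBall (0 : RQNN.JointSpace N d) (M * √((N : ℝ) + d)) := fun x hx z hz =>
    RQNN.joint_mem_closedBall hM (fun j => (hx j).trans hRM) (hDM z hz)
  have herr : ∀ x ∈ RQNN.cube N R, ∀ z ∈ D,
      ‖RQNN.rqnnMap R V θ (RQNN.joint x z) - F (RQNN.joint x z)‖ ≤ √(N : ℝ) * (C / √n) := by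
    intro x hx z hz
    have := RQNN.euclidean_norm_le (v := RQNN.rqnnMap R V θ (RQNN.joint x z) -
      F (RQNN.joint x z)) hCn fun j => by
        rw [hdiff]
        exact (hEbound j _ (hball x hx z hz)).1.trans (hCj j)
    simpa using this
  have herrlip : ∀ x ∈ RQNN.cube N R, ∀ y ∈ RQNN.cube N R, ∀ z ∈ D,
      ‖(RQNN.rqnnMap R V θ (RQNN.joint x z) - F (RQNN.joint x z)) -
        (RQNN.rqnnMap R V θ (RQNN.joint y z) - F (RQNN.joint y z))‖ ≤
        √(N : ℝ) * (C / √n * ‖x - y‖) := by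
    intro x hx y hy z hz
    have := RQNN.euclidean_norm_le (v := (RQNN.rqnnMap R V θ (RQNN.joint x z) -
      F (RQNN.joint x z)) - (RQNN.rqnnMap R V θ (RQNN.joint y z) - F (RQNN.joint y z)))
      (b := C / √n * ‖x - y‖) (by positivity) fun j => by
        rw [PiLp.sub_apply, hdiff, hdiff, ← RQNN.norm_joint_sub x y z]
        exact (convex_closedBall _ _).norm_image_sub_le_of_norm_fderiv_le
          (fun w _ => hEdiff j w) (fun w hw => (hEbound j w hw).2.trans (hCj j))
          (hball y hy z hz) (hball x hx z hz)
    simpa using this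
  have hsmall : √(N : ℝ) * (C / √n) < 1 - lam := by
    refine lt_of_pow_lt_pow_left₀ 2 hlam.le ?_
    rw [mul_pow, div_pow, Real.sq_sqrt (Nat.cast_nonneg N), Real.sq_sqrt hn'.le, mul_div_assoc',
      div_lt_iff₀ hn']
    rw [div_lt_iff₀ (by positivity)] at hn
    -- Smallness of the perturbation needs only `N * C ^ 2 < (1 - lam) ^ 2 * n`; the threshold with
    -- `N ^ 2` is stronger.
    have hNN : (N : ℝ) ≤ N ^ 2 := by exact_mod_cast Nat.le_self_pow two_ne_zero N
    nlinarith [mul_le_mul_of_nonneg_right hNN (sq_nonneg C)]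
  have hGcube : ∀ w, RQNN.rqnnMap R V θ w ∈ RQNN.cube N R :=
    RQNN.rqnnMap_mem_cube hn0 hR.le hV θ
  have hESP' : RQNN.EchoStateProperty (RQNN.rqnnMap R V θ) Set.univ D := by
    refine RQNN.echoStateProperty_of_contracting Set.univ_nonempty (S := RQNN.cube N R)
      (Set.subset_univ _) (RQNN.isClosed_cube N R)
      (fun x hx => RQNN.norm_le_of_mem_cube hR.le hx) (fun x _ z _ => hGcube _)
      (c := lam + √(N : ℝ) * (C / √n)) (by positivity) (by linarith) fun x hx y hy z hz => ?_
    have h := norm_add_le (F (RQNN.joint x z) - F (RQNN.joint y z))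
      ((RQNN.rqnnMap R V θ (RQNN.joint x z) - F (RQNN.joint x z)) -
        (RQNN.rqnnMap R V θ (RQNN.joint y z) - F (RQNN.joint y z)))
    have heq : F (RQNN.joint x z) - F (RQNN.joint y z) +
        ((RQNN.rqnnMap R V θ (RQNN.joint x z) - F (RQNN.joint x z)) -
          (RQNN.rqnnMap R V θ (RQNN.joint y z) - F (RQNN.joint y z))) =
        RQNN.rqnnMap R V θ (RQNN.joint x z) - RQNN.rqnnMap R V θ (RQNN.joint y z) := by abel
    rw [heq] at h
    linarith [hFlip z hz x y, herrlip x hx y hy z hz]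
  refine ⟨hESP', fun z t => ?_⟩
  have hx := RQNN.stateFilter_isSolution hESP z
  have hy := RQNN.stateFilter_isSolution hESP' z
  have hxc : ∀ t, (RQNN.stateFilter hESP z t : EuclideanSpace ℝ (Fin N)) ∈ RQNN.cube N R :=
    fun t => by rw [hx t]; exact hFcube _
  have hyc : ∀ t, (RQNN.stateFilter hESP' z t : EuclideanSpace ℝ (Fin N)) ∈ RQNN.cube N R :=
    fun t => by rw [hy t]; exact hGcube _
  rw [mul_div_assoc]
  -- The one-step difference splits into `F` at the two states, contracted by `lam`, and `F` minus
  -- the network at the network's own state, which lies in the cube. Hence the rate is `lam`, not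
  -- the larger contraction constant of the network.
  refine RQNN.norm_sub_le_of_contracting hlam0.le hlam1
    (x := fun t => (RQNN.stateFilter hESP z t : EuclideanSpace ℝ (Fin N)))
    (y := fun t => (RQNN.stateFilter hESP' z t : EuclideanSpace ℝ (Fin N)))
    (K := √(N : ℝ) * R + √(N : ℝ) * R) (fun t => (norm_sub_le _ _).trans (add_le_add
      (RQNN.norm_le_of_mem_cube hR.le (hxc t)) (RQNN.norm_le_of_mem_cube hR.le (hyc t))))
    (fun t => ?_) t
  have h1 := hFlip (z t) (z t).2 (RQNN.stateFilter hESP z t.prev) (RQNN.stateFilter hESP' z t.prev)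
  have h2 := herr _ (hyc t.prev) (z t) (z t).2
  rw [norm_sub_rev] at h2
  rw [← hx t] at h1
  rw [← hy t] at h2
  exact (norm_sub_le_norm_sub_add_norm_sub _ _ _).trans (add_le_add h1 h2)
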